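/- **Linear quantum Landau damping.** Let $\mathbb T^3=\mathbb R^3/\mathbb Z^3$ and write $\hat f(k)=\int_{\mathbb T^3}f(x)e^{-2\pi i k\cdot x}\,dx$ and $\hat f(k,\eta)=\int_{\mathbb R^3}\int_{\mathbb T^3}f(x,v)e^{-2\pi i k\cdot x}e^{-2\pi i\eta\cdot v}\,dx\,dv$ for $k\in\mathbb Z^3$, $\eta\in\mathbb R^3$; $\hat f(l,v)$ denotes the Fourier coefficient in $x$ only. For $\lambda,\mu>0$ and $\tau\in\mathbb R$ put $$\|g\|_{\mathcal C^{\lambda;1}}=\sum_{n\in\mathbb N_0^3}\frac{\lambda^{|n|}}{n!}\|\nabla_v^n g\|_{L^1(\mathbb R^3)},\qquad \|f\|_{\mathcal Z^{\lambda,\mu;1}_\tau}=\sum_{l\in\mathbb Z^3}\sum_{n\in\mathbb N_0^3}\frac{\lambda^{|n|}}{n!}e^{2\pi\mu|l|}\big\|(\nabla_v+2\pi i\tau l)^n\hat f(l,\cdot)\big\|_{L^1(\mathbb R^3)},$$ for $g=g(v)$ and $f=f(x,v)$ (the norms are $+\infty$ if the functions of $v$ involved are not smooth), and $\mathcal Z^{\lambda,\mu;1}=\mathcal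 Z^{\lambda,\mu;1}_0$. For $\hbar,m>0$, $e\in\mathbb R$, an integrable $W:\mathbb T^3\to\mathbb R$ and a velocity profile $w^0_\hbar=w^0_\hbar(v)$, consider classical solutions $w_\hbar(t,x,v)$, $t\ge0$, of the linearized Wigner equation $$\partial_tw_\hbar+v\cdot\nabla_xw_\hbar+\frac em\Theta_\hbar[\phi]w^0_\hbar=0,\qquad \phi=W*n_\hbar,\qquad n_\hbar(t,x)=\int_{\mathbb R^3}w_\hbar(t,x,v)\,dv,\qquad w_\hbar(0,\cdot,\cdot)=w_{\hbar I},$$ $$(\Theta_\hbar[\phi]w^0_\hbar)(t,x,v)=\frac{im}{(2\pi)^3}\int_{\mathbb R^3}\int_{\mathbb R^3}\frac{\phi(t,x+\frac{\hbar}{2m}\eta)-\phi(t,x-\frac{\hbar}{2m}\eta)}{\hbar}\,w^0_\hbar(v')e^{i(v-v')\cdot\eta}\,dv'\,d\eta.$$ Here "classical solution" means: for each $v$ the function $(t,x)\mapsto w_\hbar(t,x,v)$ is continuous on $[0,\infty)\times\mathbb T^3$ and $C^1$ on $(0,\infty)\times\mathbb T^3$, the equation holds for all $t>0$, and $w_\hbar(t)\in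 L^1(\mathbb T^3\times\mathbb R^3)$ for all $t\ge 0$ with norm bounded for $t$ in bounded intervals. There is a function $C(C_0,\delta_0)$ such that the following holds. Let $e\in\mathbb R$, $m>0$, $\gamma\ge1$, $\bar\lambda>\lambda>0$, $\bar\mu>\mu>0$, $C_0>0$. Then every sufficiently small $\delta_0>0$ (with a threshold depending only on these constants) has the following property. Let $\hbar>0$ and let $b=b(t,\tau)>0$ be a function defined for $0<\tau\le t$. Assume 1. $\hat W(0)=0$ and $|\hat W(k)|\le \frac1{1+|k|^\gamma}$ for all $k\in\mathbb Z^3$; 2. $\|w^0_\hbar\|_{\mathcal C^{\lambda;1}}\le C_0$; 3. $\|w_{\hbar I}\|_{\mathcal Z^{\lambda,\mu;1}}\le\delta_0$; 4. (quantum stability condition) for every $l\in\mathbb Z^3\setminus\{0\}$, with the wave vector $\kappa=2\pi l$, the function $$\delta w^0_\hbar(x,v)=\frac{w^0_\hbar\big(v-\frac{\hbar}{2m}\kappa\big)-w^0_\hbar\big(v+\frac{\hbar}{2m}\kappa\big)}{\frac{\hbar}{m}|\kappa|}$$ satisfies, for all $0<\tau\le t$ and with $b=b(t,\tau)$, $$\Big\|\int_{\mathbb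 T^3}\delta w^0_\hbar(x,\cdot)\,dx\Big\|_{\mathcal C^{\bar\lambda(1+b);1}}\le\delta_0,\qquad \|\delta w^0_\hbar\|_{\mathcal Z^{\bar\lambda(1+b),\bar\mu;1}_{\tau-\frac{bt}{1+b}}}\le\delta_0 .$$ Let $w_{\hbar}$ be a classical solution, and let $\bar w_{\hbar I}(v)=\int_{\mathbb T^3}w_{\hbar I}(x,v)\,dx$ and $n_{\hbar I}=\int_{\mathbb T^3}\int_{\mathbb R^3}w_{\hbar I}(x,v)\,dv\,dx$, regarded as functions that do not depend on $x$ (so that their Fourier coefficients with $k\ne0$ vanish). Then for all $t\ge0$, $k\in\mathbb Z^3$ and $\eta\in\mathbb R^3$ $$|\hat w_\hbar(t,k,\eta)-\hat{\bar w}_{\hbar I}(k,\eta)|\le C(C_0,\delta_0)\,e^{-2\pi\lambda|\eta+kt|}e^{-2\pi\mu|k|},$$ $$|\hat n_\hbar(t,k)-\hat n_{\hbar I}(k)|\le C(C_0,\delta_0)\,e^{-2\pi(\lambda t+\mu)|k|},$$ $$|\hat\phi(t,k)|\le C(C_0,\delta_0)\,e^{-2\pi\lambda|k|t}e^{-2\pi\mu|k|}.$$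 -/

import Mathlib

open scoped ENNReal ContDiff RealInnerProductSpace FourierTransform
open MeasureTheory

noncomputable section

namespace QuantumLandau

/-- Velocity space `ℝ³` with the Euclidean norm. -/
abbrev V3 : Type := EuclideanSpace ℝ (Fin 3)

/-- The torus `𝕋³ = ℝ³ / ℤ³`, with its Haar probability measure as volume. -/
abbrev T3 : Type := UnitAddTorus (Fin 3)

/-- The quotient map `ℝ³ → 𝕋³`. -/
def proj (x : V3) : T3 := fun i => ((x i : ℝ) : UnitAddCircle)

/-- A lattice vector `k ∈ ℤ³` as an element of `ℝ³`; `‖vec k‖` is its Euclidean length `|k|`. -/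
def vec (k : Fin 3 → ℤ) : V3 := WithLp.toLp 2 (fun i => (k i : ℝ))

/-! ### Fourier transforms, with the kernels `e^{-2πi k·x}` and `e^{-2πi η·v}` -/

/-- `f̂(k) = ∫_{𝕋³} f(x) e^{-2πi k·x} dx` for `f = f(x)`. -/
def fourierX (f : T3 → ℝ) (k : Fin 3 → ℤ) : ℂ :=
  UnitAddTorus.mFourierCoeff (fun x => (f x : ℂ)) k

/-- `f̂(k, η) = ∫_{ℝ³} ∫_{𝕋³} f(x,v) e^{-2πi k·x} e^{-2πi η·v} dx dv` for `f = f(x,v)`. -/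
def fourierXV (f : T3 → V3 → ℝ) (k : Fin 3 → ℤ) (η : V3) : ℂ :=
  𝓕 (fun v : V3 => fourierX (fun x => f x v) k) η

/-! ### Analytic norms -/

/-- The `i`-th component of the operator `∇_v + i a`, for `a ∈ ℝ³`. -/
def shiftedDeriv (a : V3) (i : Fin 3) (g : V3 → ℂ) : V3 → ℂ := fun v =>
  fderiv ℝ g v (EuclideanSpace.single i 1) + Complex.I * ((a i : ℝ) : ℂ) * g v

/-- `(∇_v + i a)ⁿ g` for a multi-index `n ∈ ℕ₀³`. -/
def shiftedDerivMulti (a : V3) (n : Fin 3 → ℕ) (g : V3 → ℂ) : V3 → ℂ :=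
  (shiftedDeriv a 0)^[n 0] ((shiftedDeriv a 1)^[n 1] ((shiftedDeriv a 2)^[n 2] g))

open Classical in
/-- `∑_{n ∈ ℕ₀³} (λⁿ / n!) ‖(∇_v + i a)ⁿ g‖_{L^p(ℝ³)}`, with the value `∞` if `g` is not smooth. -/
def shiftedNorm (lam : ℝ) (p : ℝ≥0∞) (a : V3) (g : V3 → ℂ) : ℝ≥0∞ :=
  if ContDiff ℝ ∞ g then
    ∑' n : Fin 3 → ℕ,
      ENNReal.ofReal (lam ^ (∑ i, n i) / ∏ i, ((n i).factorial : ℝ)) *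
        eLpNorm (shiftedDerivMulti a n g) p volume
  else ⊤

/-- The norm of `𝓒^{λ;p}` for functions of `v`: `∑_n (λⁿ / n!) ‖∇_vⁿ g‖_{L^p}`. -/
def normC (lam : ℝ) (p : ℝ≥0∞) (g : V3 → ℝ) : ℝ≥0∞ :=
  shiftedNorm lam p 0 (fun v => (g v : ℂ))

/-- The time-shifted hybrid norm of `𝓩^{λ,μ;p}_τ` for functions of `(x,v)`:
`∑_{l ∈ ℤ³} ∑_n (λⁿ / n!) e^{2πμ|l|} ‖(∇_v + 2πiτ l)ⁿ f̂(l,·)‖_{L^p}`, where `f̂(l,v)` is the Fourier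
coefficient in `x`. The norm of `𝓩^{λ,μ;p}` is the case `τ = 0`. -/
def normZ (lam mu : ℝ) (p : ℝ≥0∞) (τ : ℝ) (f : T3 → V3 → ℝ) : ℝ≥0∞ :=
  ∑' l : Fin 3 → ℤ,
    ENNReal.ofReal (Real.exp (2 * Real.pi * mu * ‖vec l‖)) *
      shiftedNorm lam p ((2 * Real.pi * τ) • vec l) (fun v => fourierX (fun x => f x v) l)

/-! ### The linearized Wigner equation -/

/-- The density `n(x) = ∫ f(x,v) dv`. -/
def density (f : T3 → V3 → ℝ) (x : T3) : ℝ := ∫ v : V3, f x v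

/-- The potential `φ = W * n` on the torus. -/
def potential (W n : T3 → ℝ) (x : T3) : ℝ := ∫ y : T3, W y * n (x - y)

/-- The pseudo-differential operator
`(Θ_ħ[φ] f)(x,v) = i m / (2π)³ ∫ ∫ (φ(x + ħη/2m) - φ(x - ħη/2m)) / ħ · f(x,v') e^{i(v-v')·η} dv' dη`. -/
def theta (hbar m : ℝ) (φ : T3 → ℝ) (f : T3 → V3 → ℝ) (x : T3) (v : V3) : ℂ :=
  Complex.I * (m : ℂ) / (2 * (Real.pi : ℂ)) ^ 3 *
    ∫ η : V3, ∫ v' : V3,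
      (((φ (x + proj ((hbar / (2 * m)) • η)) - φ (x - proj ((hbar / (2 * m)) • η))) / hbar : ℝ) : ℂ)
        * (f x v' : ℂ) * Complex.exp (Complex.I * ((⟪v - v', η⟫ : ℝ) : ℂ))

/-- `w = w(t,x,v)`, `t ≥ 0`, is a classical solution of
`∂_t w + v·∇_x w + (e/m) Θ_ħ[φ] w⁰ = 0`, `φ = W * ∫ w dv`, `w(0,·,·) = w_I`, linearized about the
velocity profile `w⁰ = w⁰(v)`. Functions of `x ∈ 𝕋³` are differentiated through their periodic
lifts to `ℝ³`. -/
structure IsSolution (hbar m e : ℝ) (W : T3 → ℝ) (w0 : V3 → ℝ) (wI : T3 → V3 → ℝ)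
    (w : ℝ → T3 → V3 → ℝ) : Prop where
  integrable : ∀ t : ℝ, 0 ≤ t → Integrable (fun p : T3 × V3 => w t p.1 p.2)
  locally_bounded : ∀ T : ℝ, ∃ M : ℝ, ∀ t : ℝ, 0 ≤ t → t ≤ T →
    ∫ p : T3 × V3, |w t p.1 p.2| ≤ M
  continuousOn : ∀ v : V3,
    ContinuousOn (fun q : ℝ × V3 => w q.1 (proj q.2) v) (Set.Ici 0 ×ˢ Set.univ)
  contDiffOn : ∀ v : V3,
    ContDiffOn ℝ 1 (fun q : ℝ × V3 => w q.1 (proj q.2) v) (Set.Ioi 0 ×ˢ Set.univ)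
  equation : ∀ t : ℝ, 0 < t → ∀ x v : V3,
    ((deriv (fun s : ℝ => w s (proj x) v) t
        + fderiv ℝ (fun y : V3 => w t (proj y) v) x v : ℝ) : ℂ)
      + ((e / m : ℝ) : ℂ)
        * theta hbar m (potential W (density (w t))) (fun _ v' => w0 v') (proj x) v = 0
  initial : ∀ (x : T3) (v : V3), w 0 x v = wI x v

/-! ### The quantum stability condition -/

/-- The finite difference
`δ_l f(x,v) = (f(x, v - ħκ/2m) - f(x, v + ħκ/2m)) / (ħ|κ|/m)` for the wave vector `κ = 2πl` of the
Fourier mode `e^{2πi l·x}`. -/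
def deltaW (hbar m : ℝ) (l : Fin 3 → ℤ) (f : T3 → V3 → ℝ) (x : T3) (v : V3) : ℝ :=
  (f x (v - (hbar / (2 * m)) • ((2 * Real.pi) • vec l))
      - f x (v + (hbar / (2 * m)) • ((2 * Real.pi) • vec l)))
    / (hbar / m * ‖(2 * Real.pi) • vec l‖)

/-- The quantum stability condition with constant `δ₀`, for a positive function `b = b(t,τ)`. -/
def StabilityCondition (hbar m lamb mub δ₀ : ℝ) (b : ℝ → ℝ → ℝ) (w0 : V3 → ℝ) : Prop :=
  ∀ l : Fin 3 → ℤ, l ≠ 0 → ∀ t τ : ℝ, 0 < τ → τ ≤ t →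
    normC (lamb * (1 + b t τ)) 1 (fun v => ∫ x : T3, deltaW hbar m l (fun _ v' => w0 v') x v)
        ≤ ENNReal.ofReal δ₀ ∧
    normZ (lamb * (1 + b t τ)) mub 1 (τ - b t τ * t / (1 + b t τ))
        (deltaW hbar m l (fun _ v' => w0 v')) ≤ ENNReal.ofReal δ₀

/-! ### The asymptotic states -/

/-- The spatial mean `∫_{𝕋³} f(x,v) dx`, as an `x`-independent function on phase space. -/
def spatialMean (f : T3 → V3 → ℝ) : T3 → V3 → ℝ := fun _ v => ∫ x : T3, f x v

/-- The total mass `∫_{𝕋³} ∫_{ℝ³} f(x,v) dv dx`, as a constant function on the torus. -/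
def meanDensity (f : T3 → V3 → ℝ) : T3 → ℝ := fun _ => ∫ x : T3, ∫ v : V3, f x v

end QuantumLandau

end

open QuantumLandau

namespace QuantumLandau

/-! ### Exponential decay of Fourier transforms of analytic functions -/

/-! The equation decouples in the spatial frequency `k`. Along free trajectories, the phase `e^{2πi
t k·v}` times the mode `ŵ(t,k,v)` has derivative `(i/ħ) e Ŵ(k) n̂(t,k)` times the same phase and the
velocity increment of `w⁰`. Integrating in time and transforming in `v` gives a Duhamel formula
(`exists_duhamel`): `ŵ(t,k,η)` is the free part `ŵ_I(k, η + tk)` plus a time integral of the force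
amplitude against the transformed increment at `η + (t-s)k`. At `η = 0` this is a closed Volterra
inequality for `n̂(·,k)`.

The analytic norms become exponential decay in `η`, since their weights sum to an exponential
(`norm_fourier_le_of_shiftedNorm_le`). The initial datum thus decays at rate `λ`, and the stability
condition bounds the transformed increment by `(ħ/m)·2π|k|·δ₀` with the faster rate `λ̄`. The factor
`ħ` cancels the `1/ħ` of the equation. The gap `λ̄ - λ` makes the time integral converge with a gain
`1/|k|`, which cancels the remaining `|k|` (`norm_integral_mul_le`).

For `k ≠ 0`, let `S` be the supremum over `[0,t]` of `|n̂(s,k)| e^{2π(λs+μ)|k|}`. It is finite by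
the local `L¹` bound, and for small `δ₀` the Duhamel formula gives `S ≤ δ₀ + S/2`, so `S ≤ 2δ₀`.
Inserting this once more at arbitrary `η` bounds the whole mode. For `k = 0` the force vanishes
because `Ŵ(0) = 0`, so the mode is frozen at its initial value. -/

theorem shiftedDeriv_zero (i : Fin 3) (g : V3 → ℂ) :
    shiftedDeriv 0 i g = fun v => fderiv ℝ g v (EuclideanSpace.single i 1) := by
  ext v
  simp [shiftedDeriv]

theorem contDiff_shiftedDeriv_zero {i : Fin 3} {g : V3 → ℂ} (hg : ContDiff ℝ ∞ g) :
    ContDiff ℝ ∞ (shiftedDeriv 0 i g) := by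
  rw [shiftedDeriv_zero]
  exact (hg.fderiv_right (m := ∞) (by simp)).clm_apply contDiff_const

theorem contDiff_iterate_shiftedDeriv_zero {i : Fin 3} {g : V3 → ℂ} (hg : ContDiff ℝ ∞ g) (n : ℕ) :
    ContDiff ℝ ∞ ((shiftedDeriv 0 i)^[n] g) := by
  induction n with
  | zero => simpa using hg
  | succ n ih =>
    rw [Function.iterate_succ_apply']
    exact contDiff_shiftedDeriv_zero ih

theorem contDiff_shiftedDerivMulti_zero {g : V3 → ℂ} (hg : ContDiff ℝ ∞ g) (n : Fin 3 → ℕ) :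
    ContDiff ℝ ∞ (shiftedDerivMulti 0 n g) :=
  contDiff_iterate_shiftedDeriv_zero (contDiff_iterate_shiftedDeriv_zero
    (contDiff_iterate_shiftedDeriv_zero hg _) _) _

theorem fourier_eq_integral_exp_mul (g : V3 → ℂ) (η : V3) :
    𝓕 g η = ∫ v : V3, Complex.exp (((-2 * Real.pi * ⟪v, η⟫ : ℝ) : ℂ) * Complex.I) * g v := by
  simp [Real.fourier_eq']

theorem norm_fourier_le_integral_norm (g : V3 → ℂ) (η : V3) : ‖𝓕 g η‖ ≤ ∫ v : V3, ‖g v‖ := by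
  rw [fourier_eq_integral_exp_mul]
  refine (norm_integral_le_integral_norm _).trans (le_of_eq ?_)
  congr 1 with v
  rw [norm_mul, Complex.norm_exp_ofReal_mul_I, one_mul]

theorem _root_.MeasureTheory.Integrable.exp_ofReal_mul_I_mul {α : Type*} [MeasurableSpace α]
    {μ : Measure α} {g : α → ℂ} (hg : Integrable g μ) {u : α → ℝ} (hu : Measurable u) :
    Integrable (fun x => Complex.exp ((u x : ℂ) * Complex.I) * g x) μ := by
  refine hg.bdd_mul (c := 1) ?_ ?_
  · exact (by fun_prop : Measurable fun x => Complex.exp ((u x : ℂ) * Complex.I)).aestronglyMeasurable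
  · exact Filter.Eventually.of_forall fun x => (Complex.norm_exp_ofReal_mul_I _).le

/-- Integration by parts against the character. Integrability of `g` and of its derivative suffices
to discard boundary terms. -/
theorem fourier_shiftedDeriv_zero {i : Fin 3} {g : V3 → ℂ} (hg : ContDiff ℝ ∞ g)
    (hi : Integrable g) (hi' : Integrable (shiftedDeriv 0 i g)) (η : V3) :
    𝓕 (shiftedDeriv 0 i g) η = (2 * Real.pi * η i : ℝ) * Complex.I * 𝓕 g η := by
  rw [shiftedDeriv_zero] at hi' ⊢
  set f : V3 → ℂ := fun v => Complex.exp (((-2 * Real.pi * ⟪v, η⟫ : ℝ) : ℂ) * Complex.I) with hf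
  have hm : Measurable fun v : V3 => -2 * Real.pi * ⟪v, η⟫ := by fun_prop
  have hfd : ∀ v, HasFDerivAt f (f v • ((Complex.ofRealCLM.comp
      ((-2 * Real.pi) • (innerSL ℝ η))).smulRight Complex.I)) v := by
    intro v
    have h1 : HasFDerivAt (fun v : V3 => (((-2 * Real.pi * ⟪v, η⟫ : ℝ) : ℂ) * Complex.I))
        ((Complex.ofRealCLM.comp ((-2 * Real.pi) • (innerSL ℝ η))).smulRight Complex.I) v := by
      have := ((Complex.ofRealCLM.comp
        ((-2 * Real.pi) • (innerSL ℝ η))).smulRight Complex.I).hasFDerivAt (x := v)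
      refine this.congr_of_eventuallyEq (Filter.Eventually.of_forall fun w => ?_)
      simp [real_inner_comm]
    exact h1.cexp
  have hfd' : ∀ v, fderiv ℝ f v (EuclideanSpace.single i 1)
      = -((2 * Real.pi * η i : ℝ) * Complex.I) * f v := by
    intro v
    rw [(hfd v).fderiv]
    simp [EuclideanSpace.inner_single_right]
    ring
  have key := integral_mul_fderiv_eq_neg_fderiv_mul_of_integrable (μ := (volume : Measure V3))
    (f := f) (g := g) (v := EuclideanSpace.single i 1)
    (by
      simp_rw [hfd', mul_assoc]
      exact ((hi.exp_ofReal_mul_I_mul hm).const_mul _))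
    (hi'.exp_ofReal_mul_I_mul hm) (hi.exp_ofReal_mul_I_mul hm)
    (fun v _ => (hfd v).differentiableAt)
    (fun v _ => hg.differentiable (by simp) v)
  rw [fourier_eq_integral_exp_mul, fourier_eq_integral_exp_mul, key, ← integral_const_mul,
    ← integral_neg]
  congr 1 with v
  rw [hfd']
  ring

theorem fourier_iterate_shiftedDeriv_zero {i : Fin 3} {g : V3 → ℂ} (hg : ContDiff ℝ ∞ g)
    (hi : ∀ n, Integrable ((shiftedDeriv 0 i)^[n] g)) (η : V3) (n : ℕ) :
    𝓕 ((shiftedDeriv 0 i)^[n] g) η = ((2 * Real.pi * η i : ℝ) * Complex.I) ^ n * 𝓕 g η := by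
  induction n with
  | zero => simp
  | succ n ih =>
    have h := hi (n + 1)
    rw [Function.iterate_succ_apply'] at h ⊢
    rw [fourier_shiftedDeriv_zero (contDiff_iterate_shiftedDeriv_zero hg n) (hi n) h, ih]
    ring

theorem norm_fourier_shiftedDerivMulti_zero {g : V3 → ℂ} (hg : ContDiff ℝ ∞ g)
    (hi : ∀ n, Integrable (shiftedDerivMulti 0 n g)) (η : V3) (n : Fin 3 → ℕ) :
    ‖𝓕 (shiftedDerivMulti 0 n g) η‖ = (∏ i, (2 * Real.pi * |η i|) ^ n i) * ‖𝓕 g η‖ := by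
  have h2 := contDiff_iterate_shiftedDeriv_zero (i := 2) hg (n 2)
  have h1 := contDiff_iterate_shiftedDeriv_zero (i := 1) h2 (n 1)
  rw [shiftedDerivMulti, fourier_iterate_shiftedDeriv_zero h1,
    fourier_iterate_shiftedDeriv_zero h2, fourier_iterate_shiftedDeriv_zero hg,
    Fin.prod_univ_three]
  · simp [abs_of_pos Real.pi_pos]
    ring
  -- The intermediate iterates are themselves multi-index derivatives, with zero in the directions
  -- not yet applied.
  · intro j
    simpa [shiftedDerivMulti] using hi ![0, 0, j]
  · intro j
    simpa [shiftedDerivMulti] using hi ![0, j, n 2]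
  · intro j
    simpa [shiftedDerivMulti] using hi ![j, n 1, n 2]

theorem contDiff_of_shiftedNorm_ne_top {lam : ℝ} {p : ℝ≥0∞} {a : V3} {g : V3 → ℂ}
    (h : shiftedNorm lam p a g ≠ ⊤) : ContDiff ℝ ∞ g := by
  by_contra hg
  simp [shiftedNorm, hg] at h

theorem integrable_shiftedDerivMulti_of_shiftedNorm_ne_top {lam : ℝ} (hlam : 0 < lam) {g : V3 → ℂ}
    (h : shiftedNorm lam 1 0 g ≠ ⊤) (n : Fin 3 → ℕ) : Integrable (shiftedDerivMulti 0 n g) := by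
  have hg := contDiff_of_shiftedNorm_ne_top h
  rw [shiftedNorm, if_pos hg] at h
  have hn := ENNReal.ne_top_of_tsum_ne_top h n
  rw [← memLp_one_iff_integrable]
  refine ⟨(contDiff_shiftedDerivMulti_zero hg n).continuous.aestronglyMeasurable, ?_⟩
  by_contra htop
  rw [not_lt, top_le_iff] at htop
  rw [htop, ENNReal.mul_top] at hn
  · exact hn rfl
  · have : 0 < lam ^ (∑ i, n i) / ∏ i, ((n i).factorial : ℝ) := by positivity
    simpa using this

theorem integrable_of_shiftedNorm_ne_top {lam : ℝ} (hlam : 0 < lam) {g : V3 → ℂ}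
    (h : shiftedNorm lam 1 0 g ≠ ⊤) : Integrable g := by
  simpa [shiftedDerivMulti] using integrable_shiftedDerivMulti_of_shiftedNorm_ne_top hlam h 0

theorem norm_le_sum_abs (η : V3) : ‖η‖ ≤ ∑ i, |η i| := by
  rw [EuclideanSpace.norm_eq]
  refine Real.sqrt_le_iff.2 ⟨by positivity, ?_⟩
  simp only [Fin.sum_univ_three, Real.norm_eq_abs]
  nlinarith [abs_nonneg (η 0), abs_nonneg (η 1), abs_nonneg (η 2),
    mul_nonneg (abs_nonneg (η 0)) (abs_nonneg (η 1)),
    mul_nonneg (abs_nonneg (η 0)) (abs_nonneg (η 2)),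
    mul_nonneg (abs_nonneg (η 1)) (abs_nonneg (η 2))]

/-- Each `n`-th term of the norm dominates `λ^|n|/n! · ∏ (2π|η i|)^{n i} · |𝓕 g η|`. Summed over
`n`, the weights give `exp (2πλ ∑ |η i|)`, which is at least `exp (2πλ‖η‖)`. -/
theorem norm_fourier_le_of_shiftedNorm_le {lam M : ℝ} (hlam : 0 < lam) (hM : 0 ≤ M) {g : V3 → ℂ}
    (h : shiftedNorm lam 1 0 g ≤ ENNReal.ofReal M) (η : V3) :
    ‖𝓕 g η‖ ≤ M * Real.exp (-2 * Real.pi * lam * ‖η‖) := by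
  have htop : shiftedNorm lam 1 0 g ≠ ⊤ := ne_top_of_le_ne_top ENNReal.ofReal_ne_top h
  have hg := contDiff_of_shiftedNorm_ne_top htop
  have hi := integrable_shiftedDerivMulti_of_shiftedNorm_ne_top hlam htop
  rw [shiftedNorm, if_pos hg] at h
  -- Partial sums over the cubes `{0,…,N-1}³` factor into one-dimensional exponential series.
  have hpart : ∀ N : ℕ, (∏ i, ∑ j ∈ Finset.range N,
      (2 * Real.pi * lam * |η i|) ^ j / (j.factorial : ℝ)) * ‖𝓕 g η‖ ≤ M := by
    intro N
    rw [Finset.prod_univ_sum, Finset.sum_mul, ← ENNReal.ofReal_le_ofReal_iff hM]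
    refine le_trans ?_ ((ENNReal.sum_le_tsum (Fintype.piFinset fun _ : Fin 3 =>
      Finset.range N)).trans h)
    rw [ENNReal.ofReal_sum_of_nonneg (fun n _ => by positivity)]
    refine Finset.sum_le_sum fun n _ => ?_
    have h1 : (∏ i, (2 * Real.pi * lam * |η i|) ^ n i / ((n i).factorial : ℝ)) * ‖𝓕 g η‖
        = (lam ^ (∑ i, n i) / ∏ i, ((n i).factorial : ℝ)) * ‖𝓕 (shiftedDerivMulti 0 n g) η‖ := by
      have h2 : ∏ i, (2 * Real.pi * lam * |η i|) ^ n i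
          = lam ^ (∑ i, n i) * ∏ i, (2 * Real.pi * |η i|) ^ n i := by
        rw [← Finset.prod_pow_eq_pow_sum, ← Finset.prod_mul_distrib]
        refine Finset.prod_congr rfl fun i _ => ?_
        rw [← mul_pow]
        ring
      rw [norm_fourier_shiftedDerivMulti_zero hg hi, Finset.prod_div_distrib, h2]
      ring
    rw [h1, ENNReal.ofReal_mul (by positivity)]
    gcongr
    rw [eLpNorm_one_eq_lintegral_enorm, ← ofReal_integral_norm_eq_lintegral_enorm (hi n)]
    exact ENNReal.ofReal_le_ofReal (norm_fourier_le_integral_norm _ _)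
  have hlim : Filter.Tendsto (fun N : ℕ => (∏ i, ∑ j ∈ Finset.range N,
      (2 * Real.pi * lam * |η i|) ^ j / (j.factorial : ℝ)) * ‖𝓕 g η‖) Filter.atTop
      (nhds ((∏ i, Real.exp (2 * Real.pi * lam * |η i|)) * ‖𝓕 g η‖)) := by
    refine Filter.Tendsto.mul_const _ (tendsto_finsetProd _ fun i _ => ?_)
    have := (NormedSpace.expSeries_div_hasSum_exp (2 * Real.pi * lam * |η i|)).tendsto_sum_nat
    rwa [← Real.exp_eq_exp_ℝ] at this
  have hle := le_of_tendsto' hlim hpart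
  rw [← Real.exp_sum, ← Finset.mul_sum] at hle
  have hexp : Real.exp (2 * Real.pi * lam * ‖η‖) * ‖𝓕 g η‖ ≤ M := by
    refine le_trans ?_ hle
    gcongr
    exact norm_le_sum_abs η
  rw [show -2 * Real.pi * lam * ‖η‖ = -(2 * Real.pi * lam * ‖η‖) by ring, Real.exp_neg,
    ← div_eq_mul_inv, le_div_iff₀ (Real.exp_pos _), mul_comm]
  exact hexp

/-! ### Fourier coefficients on the torus -/

theorem volume_unitAddCircle : (volume : Measure UnitAddCircle) = AddCircle.haarAddCircle := by
  have h := AddCircle.volume_eq_smul_haarAddCircle (T := 1)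
  rwa [ENNReal.ofReal_one, one_smul] at h

instance isProbabilityMeasure_volume_unitAddCircle :
    IsProbabilityMeasure (volume : Measure UnitAddCircle) := by
  rw [volume_unitAddCircle]
  infer_instance

/-- `mFourierCoeff` integrates against normalized Haar measure, which is the volume because the
period is `1`. -/
theorem fourierX_eq_integral (f : T3 → ℝ) (k : Fin 3 → ℤ) :
    fourierX f k = ∫ x : T3, UnitAddTorus.mFourier (-k) x * (f x : ℂ) := by
  -- With the factor measure as a variable, the equality of measures can be substituted inside the
  -- product.
  have h : ∀ μ : Measure UnitAddCircle, μ = volume →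
      ∫ x : T3, UnitAddTorus.mFourier (-k) x * (f x : ℂ) ∂(Measure.pi fun _ => μ)
        = ∫ x : T3, UnitAddTorus.mFourier (-k) x * (f x : ℂ) := by
    rintro μ rfl
    rfl
  exact h _ volume_unitAddCircle.symm

theorem norm_mFourier_apply (k : Fin 3 → ℤ) (x : T3) : ‖UnitAddTorus.mFourier k x‖ = 1 := by
  simp only [UnitAddTorus.mFourier, fourier_apply, ContinuousMap.coe_mk, norm_prod, Circle.norm_coe,
    Finset.prod_const_one]

theorem mFourier_apply_add (k : Fin 3 → ℤ) (x y : T3) :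
    UnitAddTorus.mFourier k (x + y) = UnitAddTorus.mFourier k x * UnitAddTorus.mFourier k y := by
  simp [UnitAddTorus.mFourier, fourier_apply, Finset.prod_mul_distrib, AddCircle.toCircle_add]

theorem inner_vec (y : V3) (k : Fin 3 → ℤ) : ⟪y, vec k⟫ = ∑ i, (k i : ℝ) * y i := by
  simp [vec, PiLp.inner_apply]

theorem mFourier_proj (k : Fin 3 → ℤ) (y : V3) :
    UnitAddTorus.mFourier k (proj y)
      = Complex.exp (((2 * Real.pi * ⟪y, vec k⟫ : ℝ) : ℂ) * Complex.I) := by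
  rw [inner_vec]
  simp only [UnitAddTorus.mFourier, proj, ContinuousMap.coe_mk, fourier_coe_apply]
  rw [← Complex.exp_sum]
  congr 1
  push_cast
  rw [Finset.mul_sum, Finset.sum_mul]
  refine Finset.sum_congr rfl fun i _ => ?_
  ring

theorem mFourier_neg_proj (k : Fin 3 → ℤ) (y : V3) :
    UnitAddTorus.mFourier (-k) (proj y)
      = Complex.exp (((-(2 * Real.pi * ⟪y, vec k⟫) : ℝ) : ℂ) * Complex.I) := by
  rw [mFourier_proj, inner_vec, inner_vec]
  simp

theorem isOpenQuotientMap_proj : IsOpenQuotientMap proj := by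
  have h : IsOpenQuotientMap (Pi.map fun (_ : Fin 3) (a : ℝ) => (a : UnitAddCircle)) :=
    IsOpenQuotientMap.piMap fun _ => QuotientAddGroup.isOpenQuotientMap_mk
  exact h.comp (EuclideanSpace.equiv (Fin 3) ℝ).toHomeomorph.isOpenQuotientMap

theorem continuous_proj : Continuous proj := isOpenQuotientMap_proj.continuous

theorem proj_add (x y : V3) : proj (x + y) = proj x + proj y := by
  ext i
  simp [proj]

theorem proj_neg (x : V3) : proj (-x) = -proj x := by
  ext i
  simp [proj]

/-- A translation multiplies Fourier coefficients by a phase. -/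
theorem integral_mFourier_mul_translate (f : T3 → ℂ) (k : Fin 3 → ℤ) (y : V3) :
    ∫ x : T3, UnitAddTorus.mFourier (-k) x * f (x + proj y)
      = Complex.exp (((2 * Real.pi * ⟪y, vec k⟫ : ℝ) : ℂ) * Complex.I)
        * ∫ x : T3, UnitAddTorus.mFourier (-k) x * f x := by
  rw [← integral_add_right_eq_self (fun x => UnitAddTorus.mFourier (-k) x * f x) (proj y),
    ← integral_const_mul]
  congr 1 with x
  rw [mFourier_apply_add, mFourier_neg_proj, ← mul_assoc, mul_left_comm, ← Complex.exp_add]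
  simp

theorem integrable_mFourier_mul {f : T3 → ℂ} (hf : Integrable f) (k : Fin 3 → ℤ) :
    Integrable fun x : T3 => UnitAddTorus.mFourier k x * f x :=
  hf.bdd_mul (c := 1) (UnitAddTorus.mFourier k).continuous.aestronglyMeasurable
    (Filter.Eventually.of_forall fun x => (norm_mFourier_apply k x).le)

theorem integrable_potential {W n : T3 → ℝ} (hW : Integrable W) (hn : Integrable n) :
    Integrable (potential W n) :=
  hW.integrable_convolution (ContinuousLinearMap.mul ℝ ℝ) hn

theorem fourierX_potential {W n : T3 → ℝ} (hW : Integrable W) (hn : Integrable n)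
    (k : Fin 3 → ℤ) : fourierX (potential W n) k = fourierX W k * fourierX n k := by
  have hintg : Integrable (Function.uncurry fun (x y : T3) =>
      UnitAddTorus.mFourier (-k) x * ((W y : ℂ) * (n (x - y) : ℂ))) (volume.prod volume) := by
    refine Integrable.bdd_mul (c := 1) ?_ ?_ ?_
    · have h := (hW.convolution_integrand (ContinuousLinearMap.mul ℝ ℝ) hn).ofReal (𝕜 := ℂ)
      simpa using h
    · exact ((UnitAddTorus.mFourier (-k)).continuous.comp continuous_fst).aestronglyMeasurable
    · exact Filter.Eventually.of_forall fun x => (norm_mFourier_apply _ _).le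
  calc fourierX (potential W n) k
      = ∫ x : T3, ∫ y : T3, UnitAddTorus.mFourier (-k) x * ((W y : ℂ) * (n (x - y) : ℂ)) := by
        rw [fourierX_eq_integral]
        congr 1 with x
        rw [integral_const_mul, potential, ← integral_complex_ofReal]
        simp
    _ = ∫ y : T3, ∫ x : T3, UnitAddTorus.mFourier (-k) x * ((W y : ℂ) * (n (x - y) : ℂ)) :=
        integral_integral_swap hintg
    _ = ∫ y : T3, UnitAddTorus.mFourier (-k) y * (W y : ℂ) * fourierX n k := by
        congr 1 with y
        rw [fourierX_eq_integral, ← integral_add_right_eq_self _ y, ← integral_const_mul]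
        congr 1 with x
        rw [mFourier_apply_add, add_sub_cancel_right]
        ring
    _ = fourierX W k * fourierX n k := by rw [integral_mul_const, ← fourierX_eq_integral]

/-- The shear `(η, x) ↦ (η, x + cη)` preserves the product measure, so this is a tensor product
composed with it. No regularity of `φ` beyond integrability is involved. -/
theorem integrable_translate_mul {φ : T3 → ℂ} (hφ : Integrable φ) {G : V3 → ℂ}
    (hG : Integrable G) (c : ℝ) :
    Integrable (fun p : T3 × V3 => φ (p.1 + proj (c • p.2)) * G p.2) (volume.prod volume) := by
  have hmp : MeasurePreserving (fun p : V3 × T3 => (p.1, p.2 + proj (c • p.1)))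
      (volume.prod volume) (volume.prod volume) := by
    refine (MeasurePreserving.id (volume : Measure V3)).skew_product
      (g := fun (η : V3) (x : T3) => x + proj (c • η)) ?_
      (Filter.Eventually.of_forall fun η => map_add_right_eq_self _ _)
    exact (continuous_snd.add (continuous_proj.comp (continuous_fst.const_smul c))).measurable
  have h := (hmp.integrable_comp_of_integrable (hG.mul_prod hφ)).swap
  refine h.congr (Filter.Eventually.of_forall fun p => ?_)
  simp [mul_comm]

/-- Fourier coefficients of a superposition of differences of translates. -/
theorem integral_mFourier_mul_integral_translate_sub {φ : T3 → ℂ} (hφ : Integrable φ) {G : V3 → ℂ}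
    (hG : Integrable G) (c : ℝ) (k : Fin 3 → ℤ) :
    ∫ x : T3, UnitAddTorus.mFourier (-k) x *
        ∫ η : V3, (φ (x + proj (c • η)) - φ (x - proj (c • η))) * G η
      = (∫ x : T3, UnitAddTorus.mFourier (-k) x * φ x)
        * ((∫ η : V3, Complex.exp (((2 * Real.pi * ⟪c • η, vec k⟫ : ℝ) : ℂ) * Complex.I) * G η)
          - ∫ η : V3, Complex.exp (((2 * Real.pi * ⟪(-c) • η, vec k⟫ : ℝ) : ℂ) * Complex.I)
            * G η) := by
  have hsub : ∀ (x : T3) (η : V3), x - proj (c • η) = x + proj ((-c) • η) := by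
    intro x η
    rw [neg_smul, proj_neg, sub_eq_add_neg]
  simp_rw [hsub]
  have hintg : Integrable (Function.uncurry fun (x : T3) (η : V3) => UnitAddTorus.mFourier (-k) x *
      ((φ (x + proj (c • η)) - φ (x + proj ((-c) • η))) * G η)) (volume.prod volume) := by
    refine Integrable.bdd_mul (c := 1) ?_ ?_ ?_
    · refine ((integrable_translate_mul hφ hG c).sub
        (integrable_translate_mul hφ hG (-c))).congr (Filter.Eventually.of_forall fun p => ?_)
      simp [sub_mul]
    · exact ((UnitAddTorus.mFourier (-k)).continuous.comp continuous_fst).aestronglyMeasurable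
    · exact Filter.Eventually.of_forall fun x => (norm_mFourier_apply _ _).le
  simp_rw [← integral_const_mul]
  rw [integral_integral_swap hintg, ← integral_sub, ← integral_const_mul]
  · congr 1 with η
    have hsplit : ∀ x : T3, UnitAddTorus.mFourier (-k) x *
        ((φ (x + proj (c • η)) - φ (x + proj ((-c) • η))) * G η)
        = (UnitAddTorus.mFourier (-k) x * φ (x + proj (c • η))
          - UnitAddTorus.mFourier (-k) x * φ (x + proj ((-c) • η))) * G η := fun x => by ring
    simp_rw [hsplit]
    rw [integral_mul_const, integral_sub (integrable_mFourier_mul (hφ.comp_add_right _) _)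
      (integrable_mFourier_mul (hφ.comp_add_right _) _), integral_mFourier_mul_translate,
      integral_mFourier_mul_translate]
    ring
  · exact hG.exp_ofReal_mul_I_mul (by fun_prop)
  · exact hG.exp_ofReal_mul_I_mul (by fun_prop)

/-! ### The operator `Θ_ħ[φ]` on Fourier modes -/

theorem integrable_exp_neg_mul_norm {c : ℝ} (hc : 0 < c) :
    Integrable fun x : V3 => Real.exp (-(c * ‖x‖)) := by
  -- Comparison with `(1 + ‖x‖)⁻⁴`, integrable since `4 > 3`. The constant comes from `y⁴/4! ≤ e^y`
  -- at `y = c(1 + ‖x‖)`.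
  have h := (integrable_one_add_norm (E := V3) (μ := volume) (r := 4) (by simp; norm_num)).const_mul
    (24 * Real.exp c / c ^ 4)
  refine h.mono' (by fun_prop) (Filter.Eventually.of_forall fun x => ?_)
  have hx : 0 < 1 + ‖x‖ := by positivity
  have h4 := Real.pow_div_factorial_le_exp (c * (1 + ‖x‖)) (by positivity) 4
  rw [Real.norm_of_nonneg (Real.exp_pos _).le, Real.rpow_neg hx.le, Real.exp_neg,
    show (1 + ‖x‖) ^ (4 : ℝ) = (1 + ‖x‖) ^ 4 by norm_cast, div_mul_eq_mul_div,
    ← div_eq_mul_inv, div_div, inv_eq_one_div, div_le_div_iff₀ (Real.exp_pos _) (by positivity)]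
  rw [mul_add, mul_one, Real.exp_add] at h4
  have : ((4 : ℕ).factorial : ℝ) = 24 := by norm_num [Nat.factorial]
  rw [this, div_le_iff₀ (by norm_num)] at h4
  nlinarith

theorem integrable_fourier_of_shiftedNorm_le {lam M : ℝ} (hlam : 0 < lam) (hM : 0 ≤ M) {g : V3 → ℂ}
    (h : shiftedNorm lam 1 0 g ≤ ENNReal.ofReal M) : Integrable (𝓕 g) := by
  have htop : shiftedNorm lam 1 0 g ≠ ⊤ := ne_top_of_le_ne_top ENNReal.ofReal_ne_top h
  have hgi := integrable_of_shiftedNorm_ne_top hlam htop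
  have hc : 0 < 2 * Real.pi * lam := by positivity
  refine ((integrable_exp_neg_mul_norm hc).const_mul M).mono' ?_
    (Filter.Eventually.of_forall fun η => ?_)
  · exact (VectorFourier.fourierIntegral_continuous Real.continuous_fourierChar
      (innerSL ℝ).continuous₂ hgi).aestronglyMeasurable
  · convert norm_fourier_le_of_shiftedNorm_le hlam hM h η using 3
    ring

/-- Fourier inversion, with the phase shifting the point of evaluation. The variable `η` is an
angular frequency, hence the rescaling by `2π` and its Jacobian `(2π)³`. -/
theorem integral_exp_mul_fourier_smul {g : V3 → ℂ} (hg : Continuous g) (hgi : Integrable g)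
    (hgf : Integrable (𝓕 g)) (v : V3) (c : ℝ) (k : Fin 3 → ℤ) :
    ∫ η : V3, Complex.exp (((2 * Real.pi * ⟪c • η, vec k⟫ : ℝ) : ℂ) * Complex.I)
        * (Complex.exp (((⟪v, η⟫ : ℝ) : ℂ) * Complex.I) * 𝓕 g ((2 * Real.pi)⁻¹ • η))
      = (2 * Real.pi) ^ 3 * g (v + c • (2 * Real.pi) • vec k) := by
  have hpi : (2 * Real.pi) ≠ 0 := by positivity
  have h := Measure.integral_comp_smul (volume : Measure V3) (fun ξ : V3 =>
    Complex.exp (((2 * Real.pi * ⟪ξ, v + c • (2 * Real.pi) • vec k⟫ : ℝ) : ℂ) * Complex.I) * 𝓕 g ξ)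
    (2 * Real.pi)⁻¹
  have hinv := congrFun (hg.fourierInv_fourier_eq hgi hgf) (v + c • (2 * Real.pi) • vec k)
  rw [Real.fourierInv_eq'] at hinv
  simp only [smul_eq_mul] at hinv
  rw [hinv] at h
  convert h using 1
  · congr 1 with η
    rw [← mul_assoc, ← Complex.exp_add, ← add_mul, ← Complex.ofReal_add]
    congr 4
    simp only [inner_smul_left, inner_smul_right, inner_add_right, real_inner_comm v η]
    simp
    field_simp
    ring
  · have : |(((2 * Real.pi)⁻¹ ^ Module.finrank ℝ V3)⁻¹ : ℝ)| = (2 * Real.pi) ^ 3 := by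
      rw [finrank_euclideanSpace_fin, inv_pow, inv_inv, abs_of_nonneg (by positivity)]
    rw [this, Complex.real_smul]
    push_cast
    rfl

theorem theta_eq_integral_fourier (hbar m : ℝ) (φ : T3 → ℝ) (w0 : V3 → ℝ) (x : T3) (v : V3) :
    theta hbar m φ (fun _ v' => w0 v') x v
      = Complex.I * m / (2 * Real.pi) ^ 3 / hbar * ∫ η : V3,
        ((φ (x + proj ((hbar / (2 * m)) • η)) : ℂ) - φ (x - proj ((hbar / (2 * m)) • η)))
          * (Complex.exp (((⟪v, η⟫ : ℝ) : ℂ) * Complex.I)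
            * 𝓕 (fun v' => (w0 v' : ℂ)) ((2 * Real.pi)⁻¹ • η)) := by
  have hpi : (2 * Real.pi) ≠ 0 := by positivity
  rw [theta, div_mul_eq_mul_div (_ / _) (hbar : ℂ), mul_div_assoc _ _ (hbar : ℂ), ← integral_div]
  congr 2 with η
  rw [fourier_eq_integral_exp_mul, ← integral_const_mul, ← integral_const_mul, ← integral_div]
  congr 1 with v'
  have hexp : Complex.exp (Complex.I * ((⟪v - v', η⟫ : ℝ) : ℂ))
      = Complex.exp (((⟪v, η⟫ : ℝ) : ℂ) * Complex.I)
        * Complex.exp (((-2 * Real.pi * ⟪v', (2 * Real.pi)⁻¹ • η⟫ : ℝ) : ℂ) * Complex.I) := by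
    rw [← Complex.exp_add, ← add_mul, ← Complex.ofReal_add, mul_comm]
    congr 3
    rw [inner_sub_left, inner_smul_right]
    field_simp
    ring
  rw [hexp]
  push_cast
  ring

/-- On a single mode of `φ`, the translations by `±ħη/2m` become phases in `η`, and inversion turns
these into velocity shifts of `w0`. This is where the finite difference of the stability condition
arises. -/
theorem integral_mFourier_mul_theta {lam M : ℝ} (hlam : 0 < lam) (hM : 0 ≤ M) {w0 : V3 → ℝ}
    (hw0 : normC lam 1 w0 ≤ ENNReal.ofReal M) {φ : T3 → ℝ} (hφ : Integrable φ) (hbar m : ℝ)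
    (k : Fin 3 → ℤ) (v : V3) :
    ∫ x : T3, UnitAddTorus.mFourier (-k) x * theta hbar m φ (fun _ v' => w0 v') x v
      = Complex.I * m / hbar * fourierX φ k
        * (w0 (v + (hbar / (2 * m)) • (2 * Real.pi) • vec k)
          - w0 (v - (hbar / (2 * m)) • (2 * Real.pi) • vec k)) := by
  have htop : normC lam 1 w0 ≠ ⊤ := ne_top_of_le_ne_top ENNReal.ofReal_ne_top hw0
  have hcont := (contDiff_of_shiftedNorm_ne_top htop).continuous
  have hintg := integrable_of_shiftedNorm_ne_top hlam htop
  have hintF := integrable_fourier_of_shiftedNorm_le hlam hM hw0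
  have hpi : (2 * Real.pi) ≠ 0 := by positivity
  have hG : Integrable fun η : V3 => Complex.exp (((⟪v, η⟫ : ℝ) : ℂ) * Complex.I)
      * 𝓕 (fun v' => (w0 v' : ℂ)) ((2 * Real.pi)⁻¹ • η) :=
    (hintF.comp_smul (inv_ne_zero hpi)).exp_ofReal_mul_I_mul (by fun_prop)
  have hφ' : Integrable fun x => (φ x : ℂ) := hφ.ofReal
  simp_rw [theta_eq_integral_fourier, mul_left_comm _ (Complex.I * m / (2 * Real.pi) ^ 3 / hbar)]
  rw [integral_const_mul, integral_mFourier_mul_integral_translate_sub hφ' hG,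
    integral_exp_mul_fourier_smul hcont hintg hintF, integral_exp_mul_fourier_smul hcont hintg hintF,
    ← fourierX_eq_integral, neg_smul, ← sub_eq_add_neg]
  have hpi' : (Real.pi : ℂ) ≠ 0 := by exact_mod_cast Real.pi_ne_zero
  field_simp

/-! ### Fourier modes of integrable phase space functions -/

section PhaseSpace

variable {f : T3 → V3 → ℝ}

theorem integrable_mFourier_mul_phaseSpace (hf : Integrable fun p : T3 × V3 => f p.1 p.2)
    (k : Fin 3 → ℤ) :
    Integrable fun p : T3 × V3 => UnitAddTorus.mFourier (-k) p.1 * (f p.1 p.2 : ℂ) := by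
  have hf' : Integrable fun p : T3 × V3 => (f p.1 p.2 : ℂ) := hf.ofReal
  exact hf'.bdd_mul (c := 1)
    ((UnitAddTorus.mFourier (-k)).continuous.comp continuous_fst).aestronglyMeasurable
    (Filter.Eventually.of_forall fun x => (norm_mFourier_apply _ _).le)

theorem integrable_density (hf : Integrable fun p : T3 × V3 => f p.1 p.2) :
    Integrable (density f) :=
  Integrable.integral_prod_left hf

theorem integrable_fourierX (hf : Integrable fun p : T3 × V3 => f p.1 p.2) (k : Fin 3 → ℤ) :
    Integrable fun v : V3 => fourierX (fun x => f x v) k := by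
  simp_rw [fourierX_eq_integral]
  exact (integrable_mFourier_mul_phaseSpace hf k).integral_prod_right

theorem fourierX_density (hf : Integrable fun p : T3 × V3 => f p.1 p.2) (k : Fin 3 → ℤ) :
    fourierX (density f) k = fourierXV f k 0 := by
  rw [fourierXV, fourier_eq_integral_exp_mul]
  simp_rw [fourierX_eq_integral, density, ← integral_complex_ofReal, ← integral_const_mul]
  rw [integral_integral_swap (integrable_mFourier_mul_phaseSpace hf k)]
  simp

theorem norm_fourierXV_le (hf : Integrable fun p : T3 × V3 => f p.1 p.2) (k : Fin 3 → ℤ) (η : V3) :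
    ‖fourierXV f k η‖ ≤ ∫ p : T3 × V3, |f p.1 p.2| := by
  have habs : Integrable (Function.uncurry fun (x : T3) (v : V3) => |f x v|)
      (volume.prod volume) := hf.abs
  have h1 : ∫ p : T3 × V3, |f p.1 p.2| = ∫ v : V3, ∫ x : T3, |f x v| := by
    rw [← integral_integral_swap habs, integral_integral habs]
    rfl
  refine (norm_fourier_le_integral_norm _ _).trans ?_
  rw [h1]
  refine integral_mono (integrable_fourierX hf k).norm habs.integral_prod_right fun v => ?_
  simp only [fourierX_eq_integral]
  refine (norm_integral_le_integral_norm _).trans (le_of_eq ?_)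
  congr 1 with x
  simp [norm_mFourier_apply]

end PhaseSpace

/-! ### Evolution of the Fourier modes -/

namespace IsSolution

variable {hbar m e : ℝ} {W : T3 → ℝ} {w0 : V3 → ℝ} {wI : T3 → V3 → ℝ} {w : ℝ → T3 → V3 → ℝ}

/-- Freezing negative times at `0` makes the function globally continuous, so that continuity
descends through the open quotient map to the torus. -/
theorem continuous_max (hsol : IsSolution hbar m e W w0 wI w) (v : V3) :
    Continuous fun p : ℝ × T3 => w (max p.1 0) p.2 v := by
  rw [← (IsOpenQuotientMap.id.prodMap isOpenQuotientMap_proj).continuous_comp_iff]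
  refine (hsol.continuousOn v).comp_continuous (f := fun q : ℝ × V3 => (max q.1 0, q.2))
    (by fun_prop) fun q => ?_
  simp

theorem continuousOn_fourierX (hsol : IsSolution hbar m e W w0 wI w) (k : Fin 3 → ℤ) (v : V3) :
    ContinuousOn (fun t => fourierX (fun x => w t x v) k) (Set.Ici 0) := by
  have h : Continuous fun t : ℝ => ∫ x in (Set.univ : Set T3),
      UnitAddTorus.mFourier (-k) x * (w (max t 0) x v : ℂ) := by
    refine continuous_parametric_integral_of_continuous ?_ isCompact_univ
    exact ((UnitAddTorus.mFourier (-k)).continuous.comp continuous_snd).mul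
      (Complex.continuous_ofReal.comp (hsol.continuous_max v))
  refine h.continuousOn.congr fun t ht => ?_
  simp only [fourierX_eq_integral, Measure.restrict_univ, max_eq_left (Set.mem_Ici.1 ht)]

theorem continuous_of_nonneg (hsol : IsSolution hbar m e W w0 wI w) {t : ℝ} (ht : 0 ≤ t) (v : V3) :
    Continuous fun x : T3 => w t x v := by
  have h := (hsol.continuous_max v).comp (Continuous.prodMk_right t)
  simpa [Function.comp_def, max_eq_left ht] using h

/-- The derivative of a solution along a free trajectory. -/
theorem fderiv_lift (hsol : IsSolution hbar m e W w0 wI w) {t : ℝ} (ht : 0 < t) (y v : V3) :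
    ((fderiv ℝ (fun q : ℝ × V3 => w q.1 (proj q.2) v) (t, y) (1, v) : ℝ) : ℂ)
      = -(((e / m : ℝ) : ℂ)
        * theta hbar m (potential W (density (w t))) (fun _ v' => w0 v') (proj y) v) := by
  have hopen : IsOpen (Set.Ioi (0 : ℝ) ×ˢ (Set.univ : Set V3)) := isOpen_Ioi.prod isOpen_univ
  have hd : HasFDerivAt (fun q : ℝ × V3 => w q.1 (proj q.2) v)
      (fderiv ℝ (fun q : ℝ × V3 => w q.1 (proj q.2) v) (t, y)) (t, y) :=
    (((hsol.contDiffOn v).differentiableOn (by simp)).differentiableAt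
      (hopen.mem_nhds (by simpa using ht))).hasFDerivAt
  have h1 : HasDerivAt (fun s : ℝ => w s (proj y) v)
      (fderiv ℝ (fun q : ℝ × V3 => w q.1 (proj q.2) v) (t, y) (1, 0)) t :=
    hd.comp_hasDerivAt (f := fun s : ℝ => (s, y)) t ((hasDerivAt_id' t).prodMk (hasDerivAt_const t y))
  have h2 : HasFDerivAt (fun z : V3 => w t (proj z) v)
      ((fderiv ℝ (fun q : ℝ × V3 => w q.1 (proj q.2) v) (t, y)).comp
        ((0 : V3 →L[ℝ] ℝ).prod (ContinuousLinearMap.id ℝ V3))) y :=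
    hd.comp y ((hasFDerivAt_const t y).prodMk (hasFDerivAt_id y))
  have heq := hsol.equation t ht y v
  rw [h1.deriv, h2.fderiv] at heq
  rw [← eq_neg_of_add_eq_zero_left heq]
  congr 1
  have : ((1 : ℝ), v) = (1, 0) + (0, v) := by simp
  rw [this, map_add]
  simp

theorem hasDerivAt_trajectory (hsol : IsSolution hbar m e W w0 wI w) {t : ℝ} (ht : 0 < t) (x : T3)
    (v : V3) :
    HasDerivAt (fun s : ℝ => (w s (x + proj (s • v)) v : ℂ))
      (-(((e / m : ℝ) : ℂ) * theta hbar m (potential W (density (w t))) (fun _ v' => w0 v')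
        (x + proj (t • v)) v)) t := by
  obtain ⟨y, rfl⟩ := isOpenQuotientMap_proj.surjective x
  have hopen : IsOpen (Set.Ioi (0 : ℝ) ×ˢ (Set.univ : Set V3)) := isOpen_Ioi.prod isOpen_univ
  have hd : HasFDerivAt (fun q : ℝ × V3 => w q.1 (proj q.2) v)
      (fderiv ℝ (fun q : ℝ × V3 => w q.1 (proj q.2) v) (t, y + t • v)) (t, y + t • v) :=
    (((hsol.contDiffOn v).differentiableOn (by simp)).differentiableAt
      (hopen.mem_nhds (by simpa using ht))).hasFDerivAt
  have hline : HasDerivAt (fun s : ℝ => (s, y + s • v)) ((1 : ℝ), v) t := by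
    refine (hasDerivAt_id t).prodMk ?_
    simpa using ((hasDerivAt_id t).smul_const v).const_add y
  simp_rw [← proj_add]
  rw [← hsol.fderiv_lift ht]
  exact (hd.comp_hasDerivAt t hline).ofReal_comp

/-- The equation identifies the force with the derivative of the `C¹` lift in the direction `(1,
v)`. Continuity comes from there, and not from any regularity of the potential. -/
theorem continuousAt_force (hsol : IsSolution hbar m e W w0 wI w) {t : ℝ} (ht : 0 < t) (x : T3)
    (v : V3) :
    ContinuousAt (fun p : ℝ × T3 => -(((e / m : ℝ) : ℂ)
      * theta hbar m (potential W (density (w p.1))) (fun _ v' => w0 v') p.2 v)) (t, x) := by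
  obtain ⟨y, rfl⟩ := isOpenQuotientMap_proj.surjective x
  have hopen : IsOpen (Set.Ioi (0 : ℝ) ×ˢ (Set.univ : Set V3)) := isOpen_Ioi.prod isOpen_univ
  have hmem : (t, y) ∈ Set.Ioi (0 : ℝ) ×ˢ (Set.univ : Set V3) := by simpa using ht
  have hq := IsOpenQuotientMap.id (X := ℝ) |>.prodMap isOpenQuotientMap_proj
  change ContinuousAt _ (Prod.map id proj (t, y))
  rw [← hq.continuousAt_comp_iff]
  have hc := ((hsol.contDiffOn v).continuousOn_fderiv_of_isOpen hopen le_rfl).continuousAt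
    (hopen.mem_nhds hmem)
  have hc' : ContinuousAt (fun q : ℝ × V3 =>
      ((fderiv ℝ (fun q : ℝ × V3 => w q.1 (proj q.2) v) q (1, v) : ℝ) : ℂ)) (t, y) :=
    Complex.continuous_ofReal.continuousAt.comp (hc.clm_apply continuousAt_const)
  refine hc'.congr ?_
  filter_upwards [hopen.mem_nhds hmem] with q hq
  exact hsol.fderiv_lift hq.1 q.2 v

theorem hasDerivAt_exp_mul_fourierX (hsol : IsSolution hbar m e W w0 wI w) {t : ℝ} (ht : 0 < t)
    (k : Fin 3 → ℤ) (v : V3) :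
    HasDerivAt (fun s : ℝ => Complex.exp (((2 * Real.pi * (s * ⟪v, vec k⟫) : ℝ) : ℂ) * Complex.I)
        * fourierX (fun x => w s x v) k)
      (-(((e / m : ℝ) : ℂ) * Complex.exp (((2 * Real.pi * (t * ⟪v, vec k⟫) : ℝ) : ℂ) * Complex.I)
        * ∫ x : T3, UnitAddTorus.mFourier (-k) x
          * theta hbar m (potential W (density (w t))) (fun _ v' => w0 v') x v)) t := by
  set force : ℝ → T3 → ℂ := fun s x => -(((e / m : ℝ) : ℂ)
      * theta hbar m (potential W (density (w s))) (fun _ v' => w0 v') x v) with hforce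
  -- A compact time window away from `0` bounds the force uniformly, which provides the dominating
  -- constant for differentiation under the integral.
  have hcont : ContinuousOn (fun p : ℝ × T3 => force p.1 p.2) (Set.Icc (t / 2) (2 * t) ×ˢ Set.univ) :=
    fun p hp => (hsol.continuousAt_force (by linarith [hp.1.1]) p.2 v).continuousWithinAt
  obtain ⟨M, hM⟩ := (isCompact_Icc.prod isCompact_univ).exists_bound_of_continuousOn hcont
  have hnhds : Set.Icc (t / 2) (2 * t) ∈ nhds t := Icc_mem_nhds (by linarith) (by linarith)
  have hmeas : ∀ s : ℝ, 0 ≤ s → Continuous fun x : T3 =>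
      UnitAddTorus.mFourier (-k) x * (w s (x + proj (s • v)) v : ℂ) := by
    intro s hs
    have := (hsol.continuous_of_nonneg hs v).comp (continuous_add_const (proj (s • v)))
    exact (UnitAddTorus.mFourier (-k)).continuous.mul (Complex.continuous_ofReal.comp this)
  have hforcec : Continuous (force t) := by
    rw [continuous_iff_continuousAt]
    intro x
    exact (hsol.continuousAt_force ht x v).comp (f := fun x : T3 => (t, x))
      (Continuous.prodMk_right t).continuousAt
  have key := (hasDerivAt_integral_of_dominated_loc_of_deriv_le (μ := (volume : Measure T3))
    (F := fun s x => UnitAddTorus.mFourier (-k) x * (w s (x + proj (s • v)) v : ℂ))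
    (F' := fun s x => UnitAddTorus.mFourier (-k) x * force s (x + proj (s • v)))
    (bound := fun _ => M) hnhds
    (by
      filter_upwards [hnhds] with s hs
      exact (hmeas s (by linarith [hs.1])).aestronglyMeasurable)
    ((hmeas t ht.le).integrable_of_hasCompactSupport (HasCompactSupport.of_compactSpace _))
    ((UnitAddTorus.mFourier (-k)).continuous.mul
      (hforcec.comp (continuous_add_const (proj (t • v))))).aestronglyMeasurable
    (Filter.Eventually.of_forall fun x s hs => by
      rw [norm_mul, norm_mFourier_apply, one_mul]
      exact hM (s, _) ⟨hs, trivial⟩)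
    (integrable_const M)
    (Filter.Eventually.of_forall fun x s hs =>
      (hsol.hasDerivAt_trajectory (by linarith [hs.1]) x v).const_mul _)).2
  have hinner : ∀ s : ℝ, ⟪s • v, vec k⟫ = s * ⟪v, vec k⟫ := fun s => by
    rw [real_inner_smul_left]
  have hfun : (fun s : ℝ => ∫ x : T3, UnitAddTorus.mFourier (-k) x * (w s (x + proj (s • v)) v : ℂ))
      = fun s : ℝ => Complex.exp (((2 * Real.pi * (s * ⟪v, vec k⟫) : ℝ) : ℂ) * Complex.I)
        * fourierX (fun x => w s x v) k := by
    funext s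
    rw [integral_mFourier_mul_translate (fun x => (w s x v : ℂ)), fourierX_eq_integral, hinner]
  have hval : ∫ x : T3, UnitAddTorus.mFourier (-k) x * force t (x + proj (t • v))
      = -(((e / m : ℝ) : ℂ)
        * Complex.exp (((2 * Real.pi * (t * ⟪v, vec k⟫) : ℝ) : ℂ) * Complex.I)
        * ∫ x : T3, UnitAddTorus.mFourier (-k) x
          * theta hbar m (potential W (density (w t))) (fun _ v' => w0 v') x v) := by
    rw [integral_mFourier_mul_translate (force t), hinner]
    simp_rw [hforce, mul_neg, mul_left_comm _ (((e / m : ℝ) : ℂ))]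
    rw [integral_neg, integral_const_mul]
    ring
  rw [← hval, ← hfun]
  exact key

end IsSolution

/-- The increment `w⁰(v - ħκ/2m) - w⁰(v + ħκ/2m)` for `κ = 2πk`. -/
noncomputable def increment (hbar m : ℝ) (w0 : V3 → ℝ) (k : Fin 3 → ℤ) (v : V3) : ℂ :=
  (w0 (v - (hbar / (2 * m)) • (2 * Real.pi) • vec k) : ℂ)
    - w0 (v + (hbar / (2 * m)) • (2 * Real.pi) • vec k)

theorem integrable_increment {w0 : V3 → ℝ} (h : Integrable fun v => (w0 v : ℂ)) (hbar m : ℝ)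
    (k : Fin 3 → ℤ) : Integrable (increment hbar m w0 k) :=
  (h.comp_sub_right _).sub (h.comp_add_right _)

/-! ### Scalar evolution of each mode and its Duhamel formula. -/

namespace IsSolution

variable {hbar m e lam M : ℝ} {W : T3 → ℝ} {w0 : V3 → ℝ} {wI : T3 → V3 → ℝ}
  {w : ℝ → T3 → V3 → ℝ}

theorem hasDerivAt_mode (hsol : IsSolution hbar m e W w0 wI w) (hm : m ≠ 0) (hlam : 0 < lam)
    (hM : 0 ≤ M) (hw0 : normC lam 1 w0 ≤ ENNReal.ofReal M) (hW : Integrable W) {t : ℝ} (ht : 0 < t)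
    (k : Fin 3 → ℤ) (v : V3) :
    HasDerivAt (fun s : ℝ => Complex.exp (((2 * Real.pi * (s * ⟪v, vec k⟫) : ℝ) : ℂ) * Complex.I)
        * fourierX (fun x => w s x v) k)
      (Complex.I / hbar * (e * fourierX W k * fourierX (density (w t)) k)
        * (increment hbar m w0 k v
          * Complex.exp (((2 * Real.pi * (t * ⟪v, vec k⟫) : ℝ) : ℂ) * Complex.I))) t := by
  have hn := integrable_density (hsol.integrable t ht.le)
  convert! hsol.hasDerivAt_exp_mul_fourierX ht k v using 1
  rw [integral_mFourier_mul_theta hlam hM hw0 (integrable_potential hW hn), fourierX_potential hW hn,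
    increment]
  have hm' : (m : ℂ) ≠ 0 := by exact_mod_cast hm
  push_cast
  field_simp
  ring

/-- The amplitude of the force acting on the mode `k` may be taken measurable in time. -/
theorem exists_source (hsol : IsSolution hbar m e W w0 wI w) (hbar0 : hbar ≠ 0) (hm : m ≠ 0)
    (hlam : 0 < lam) (hM : 0 ≤ M) (hw0 : normC lam 1 w0 ≤ ENNReal.ofReal M) (hW : Integrable W)
    (k : Fin 3 → ℤ) :
    ∃ α : ℝ → ℂ, Measurable α ∧
      (∀ s, 0 < s → ‖α s‖ ≤ |e| * ‖fourierX W k‖ * ‖fourierX (density (w s)) k‖) ∧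
      ∀ v : V3, ∀ t, 0 < t →
        HasDerivAt (fun s : ℝ =>
          Complex.exp (((2 * Real.pi * (s * ⟪v, vec k⟫) : ℝ) : ℂ) * Complex.I)
            * fourierX (fun x => w s x v) k)
          (Complex.I / hbar * α t * (increment hbar m w0 k v
            * Complex.exp (((2 * Real.pi * (t * ⟪v, vec k⟫) : ℝ) : ℂ) * Complex.I))) t := by
  have hder := fun v t ht => hsol.hasDerivAt_mode hm hlam hM hw0 hW (t := t) ht k v
  -- Measurability of `n̂(·,k)` is not assumed. If the increment is nonzero at some `v₀`, the
  -- amplitude is recovered by dividing the time derivative of the mode at `v₀`, which is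
  -- measurable, by an explicit nonvanishing factor. If the increment vanishes identically, the
  -- amplitude is irrelevant and zero serves.
  by_cases hD : ∃ v₀, increment hbar m w0 k v₀ ≠ 0
  · obtain ⟨v₀, hv₀⟩ := hD
    set ψ : ℝ → ℂ := fun s =>
      Complex.exp (((2 * Real.pi * (s * ⟪v₀, vec k⟫) : ℝ) : ℂ) * Complex.I) with hψ
    have hψm : Measurable ψ := by fun_prop
    set α : ℝ → ℂ := fun s => deriv (fun s : ℝ => ψ s * fourierX (fun x => w s x v₀) k) s
      / (Complex.I / hbar * (increment hbar m w0 k v₀ * ψ s)) with hα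
    have hval : ∀ s, 0 < s → α s = e * fourierX W k * fourierX (density (w s)) k := by
      intro s hs
      have hψ0 : ψ s ≠ 0 := Complex.exp_ne_zero _
      have hb : (hbar : ℂ) ≠ 0 := by exact_mod_cast hbar0
      simp only [hα]
      rw [(hder v₀ s hs).deriv]
      have hI := Complex.I_ne_zero
      field_simp
      simp only [hψ]
      push_cast
      field_simp
    refine ⟨α, ?_, fun s hs => ?_, fun v t ht => ?_⟩
    · exact (measurable_deriv _).div ((hψm.const_mul _).const_mul _)
    · rw [hval s hs, norm_mul, norm_mul, Complex.norm_real, Real.norm_eq_abs]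
    · rw [hval t ht]
      exact hder v t ht
  · push Not at hD
    refine ⟨0, measurable_const, fun s _ => ?_, fun v t ht => ?_⟩
    · simp only [Pi.zero_apply, norm_zero]
      positivity
    · have := hder v t ht
      rw [hD v] at this ⊢
      simpa using this

/-- The modes of the density are controlled by the `L¹` norm on phase space. This makes the source
integrable in time and the supremum of the bootstrap finite. -/
theorem exists_source_bound (hsol : IsSolution hbar m e W w0 wI w) (k : Fin 3 → ℤ) (T : ℝ) :
    ∃ B : ℝ, 0 ≤ B ∧ ∀ s, 0 ≤ s → s ≤ T → ‖fourierX (density (w s)) k‖ ≤ B := by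
  obtain ⟨B, hB⟩ := hsol.locally_bounded T
  refine ⟨max B 0, le_max_right _ _, fun s hs hsT => ?_⟩
  rw [fourierX_density (hsol.integrable s hs)]
  exact (norm_fourierXV_le (hsol.integrable s hs) k 0).trans ((hB s hs hsT).trans (le_max_left _ _))

/-- The Duhamel formula for the mode `k`. -/
theorem exists_duhamel (hsol : IsSolution hbar m e W w0 wI w) (hbar0 : hbar ≠ 0) (hm : m ≠ 0)
    (hlam : 0 < lam) (hM : 0 ≤ M) (hw0 : normC lam 1 w0 ≤ ENNReal.ofReal M) (hW : Integrable W)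
    (k : Fin 3 → ℤ) :
    ∃ α : ℝ → ℂ,
      (∀ s, 0 < s → ‖α s‖ ≤ |e| * ‖fourierX W k‖ * ‖fourierX (density (w s)) k‖) ∧
      ∀ t, 0 ≤ t → ∀ η : V3, fourierXV (w t) k η = fourierXV wI k (η + t • vec k)
        + Complex.I / hbar
          * ∫ s in (0 : ℝ)..t, α s * 𝓕 (increment hbar m w0 k) (η + (t - s) • vec k) := by
  obtain ⟨α, hαm, hαb, hder⟩ := hsol.exists_source hbar0 hm hlam hM hw0 hW k
  refine ⟨α, hαb, fun t ht η => ?_⟩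
  have hw0i : Integrable fun v => (w0 v : ℂ) :=
    integrable_of_shiftedNorm_ne_top hlam (ne_top_of_le_ne_top ENNReal.ofReal_ne_top hw0)
  have hDi := integrable_increment hw0i hbar m k
  set D := increment hbar m w0 k with hD
  have hαi : IntegrableOn α (Set.Ioc 0 t) := by
    obtain ⟨B, hB0, hB⟩ := hsol.exists_source_bound k t
    refine Measure.integrableOn_of_bounded (M := |e| * ‖fourierX W k‖ * B) (by simp)
      hαm.aestronglyMeasurable ?_
    filter_upwards [ae_restrict_mem measurableSet_Ioc] with s hs
    exact (hαb s hs.1).trans (by gcongr; exact hB s hs.1.le hs.2)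
  have hpt : ∀ v : V3, fourierX (fun x => w t x v) k
      = Complex.exp (((-(2 * Real.pi * (t * ⟪v, vec k⟫)) : ℝ) : ℂ) * Complex.I)
        * (fourierX (fun x => wI x v) k + Complex.I / hbar * ∫ s in Set.Ioc 0 t, α s * (D v
          * Complex.exp (((2 * Real.pi * (s * ⟪v, vec k⟫) : ℝ) : ℂ) * Complex.I))) := by
    intro v
    have hintg : IntervalIntegrable (fun s => Complex.I / hbar * α s * (D v
          * Complex.exp (((2 * Real.pi * (s * ⟪v, vec k⟫) : ℝ) : ℂ) * Complex.I))) volume 0 t := by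
      rw [intervalIntegrable_iff_integrableOn_Ioc_of_le ht]
      refine ((hαi.exp_ofReal_mul_I_mul (u := fun s => 2 * Real.pi * (s * ⟪v, vec k⟫))
        (by fun_prop)).const_mul (Complex.I / hbar * D v)).congr
        (Filter.Eventually.of_forall fun s => ?_)
      simp only
      ring
    have hcont : ContinuousOn (fun s : ℝ =>
        Complex.exp (((2 * Real.pi * (s * ⟪v, vec k⟫) : ℝ) : ℂ) * Complex.I)
          * fourierX (fun x => w s x v) k) (Set.Icc 0 t) :=
      (Continuous.continuousOn (by fun_prop)).mul
        ((hsol.continuousOn_fourierX k v).mono Set.Icc_subset_Ici_self)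
    -- Differentiability holds only for positive times; continuity up to `0` covers the endpoint.
    have hftc := intervalIntegral.integral_eq_sub_of_hasDerivAt_of_le ht hcont
      (fun s hs => hder v s hs.1) hintg
    rw [intervalIntegral.integral_of_le ht] at hftc
    simp_rw [mul_assoc (Complex.I / (hbar : ℂ))] at hftc
    rw [integral_const_mul] at hftc
    rw [hftc]
    have hinit : (fun x => w 0 x v) = fun x => wI x v := funext fun x => hsol.initial x v
    simp only [zero_mul, mul_zero, Complex.ofReal_zero, Complex.exp_zero, one_mul, hinit]
    rw [add_sub_cancel, ← mul_assoc, ← Complex.exp_add]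
    simp
  have hwI : Integrable fun p : T3 × V3 => wI p.1 p.2 := by
    simpa [hsol.initial] using hsol.integrable 0 le_rfl
  have hprod : Integrable (Function.uncurry fun (v : V3) (s : ℝ) =>
      Complex.exp (((-2 * Real.pi * ⟪v, η + (t - s) • vec k⟫ : ℝ) : ℂ) * Complex.I) * (D v * α s))
      (volume.prod (volume.restrict (Set.Ioc 0 t))) := by
    refine (hDi.mul_prod hαi).exp_ofReal_mul_I_mul
      (u := fun p : V3 × ℝ => -2 * Real.pi * ⟪p.1, η + (t - p.2) • vec k⟫) ?_
    fun_prop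
  calc fourierXV (w t) k η
      = ∫ v : V3, (Complex.exp (((-2 * Real.pi * ⟪v, η + t • vec k⟫ : ℝ) : ℂ) * Complex.I)
          * fourierX (fun x => wI x v) k
        + Complex.I / hbar * ∫ s in Set.Ioc 0 t,
          Complex.exp (((-2 * Real.pi * ⟪v, η + (t - s) • vec k⟫ : ℝ) : ℂ) * Complex.I)
            * (D v * α s)) := by
        rw [fourierXV, fourier_eq_integral_exp_mul]
        congr 1 with v
        rw [hpt v, ← mul_assoc, ← Complex.exp_add, mul_add]
        congr 1
        · congr 2
          rw [inner_add_right, inner_smul_right]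
          push_cast
          ring
        · rw [mul_left_comm]
          congr 1
          rw [← integral_const_mul]
          congr 1 with s
          rw [inner_add_right, inner_smul_right,
            show ∀ a b c d : ℂ, a * (b * (c * d)) = (a * d) * (c * b) by intros; ring,
            ← Complex.exp_add]
          congr 2
          push_cast
          ring
    _ = fourierXV wI k (η + t • vec k)
        + Complex.I / hbar
          * ∫ s in (0 : ℝ)..t, α s * 𝓕 D (η + (t - s) • vec k) := by
        rw [integral_add, integral_const_mul, integral_integral_swap hprod,
          intervalIntegral.integral_of_le ht, fourierXV, fourier_eq_integral_exp_mul]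
        · congr 3 with s
          rw [fourier_eq_integral_exp_mul, ← integral_const_mul]
          congr 1 with v
          ring
        · exact (integrable_fourierX hwI k).exp_ofReal_mul_I_mul (by fun_prop)
        · exact hprod.integral_prod_left.const_mul _

end IsSolution

/-! ### Decay estimates -/

theorem integrable_exp_neg_mul_abs {c : ℝ} (hc : 0 < c) :
    Integrable fun x : ℝ => Real.exp (-c * |x|) := by
  rw [← integrableOn_univ, ← Set.Iic_union_Ioi (a := (0 : ℝ))]
  refine IntegrableOn.union ?_ ?_
  · refine (integrableOn_exp_mul_Iic hc 0).congr_fun (fun x hx => ?_) measurableSet_Iic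
    simp only [abs_of_nonpos (Set.mem_Iic.1 hx), neg_mul_neg]
  · refine (integrableOn_exp_mul_Ioi (neg_lt_zero.2 hc) 0).congr_fun (fun x hx => ?_)
      measurableSet_Ioi
    simp only [abs_of_pos (Set.mem_Ioi.1 hx)]

theorem integral_exp_neg_mul_abs_sub_le {c : ℝ} (hc : 0 < c) {t : ℝ} (ht : 0 ≤ t) (a : ℝ) :
    ∫ s in (0 : ℝ)..t, Real.exp (-c * |s - a|) ≤ 2 / c := by
  rw [intervalIntegral.integral_of_le ht]
  refine (setIntegral_le_integral ((integrable_exp_neg_mul_abs hc).comp_sub_right a)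
    (Filter.Eventually.of_forall fun s => (Real.exp_pos _).le)).trans (le_of_eq ?_)
  rw [integral_sub_right_eq_self (fun s : ℝ => Real.exp (-c * |s|)),
    integral_comp_abs (f := fun s => Real.exp (-c * s)), integral_exp_mul_Ioi (neg_lt_zero.2 hc)]
  simp
  ring

/-- `a` is the time at which `η + (t - s)u` is orthogonal to `u`. Projection onto `u` and
Cauchy–Schwarz give the bound. -/
theorem exists_norm_mul_abs_sub_le (η u : V3) (t : ℝ) :
    ∃ a : ℝ, ∀ s : ℝ, ‖u‖ * |s - a| ≤ ‖η + (t - s) • u‖ := by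
  rcases eq_or_ne u 0 with rfl | hu
  · exact ⟨0, fun s => by simp⟩
  have hu' : 0 < ‖u‖ := norm_pos_iff.2 hu
  refine ⟨t + ⟪η, u⟫ / ‖u‖ ^ 2, fun s => ?_⟩
  have hcs := abs_real_inner_le_norm (η + (t - s) • u) u
  rw [inner_add_left, real_inner_smul_left, real_inner_self_eq_norm_sq] at hcs
  have h1 : ⟪η, u⟫ + (t - s) * ‖u‖ ^ 2 = -(‖u‖ ^ 2 * (s - (t + ⟪η, u⟫ / ‖u‖ ^ 2))) := by
    field_simp
    ring
  rw [h1, abs_neg, abs_mul, abs_of_nonneg (sq_nonneg ‖u‖)] at hcs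
  nlinarith

/-- The rate is split as `lamb = lam + (lamb - lam)`. The first part combines with the decay of `α`
through the triangle inequality to give the target weight at `η + tu`; the second leaves `exp (-c|s
- a|)`, whose time integral is at most `2/c`, uniformly in `t`. -/
theorem norm_integral_mul_le {lam lamb mu A B t : ℝ} (hlam : 0 < lam) (hlamb : lam < lamb)
    (hA : 0 ≤ A) (ht : 0 ≤ t) {u : V3} (hu : u ≠ 0) {α : ℝ → ℂ} {F : V3 → ℂ}
    (hα : ∀ s, 0 < s → s ≤ t → ‖α s‖ ≤ A * Real.exp (-2 * Real.pi * (lam * s + mu) * ‖u‖))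
    (hF : ∀ ξ, ‖F ξ‖ ≤ B * Real.exp (-2 * Real.pi * lamb * ‖ξ‖)) (η : V3) :
    ‖∫ s in (0 : ℝ)..t, α s * F (η + (t - s) • u)‖
      ≤ A * B / (Real.pi * (lamb - lam) * ‖u‖) * (Real.exp (-2 * Real.pi * lam * ‖η + t • u‖)
        * Real.exp (-2 * Real.pi * mu * ‖u‖)) := by
  have hu' : 0 < ‖u‖ := norm_pos_iff.2 hu
  have hgap : 0 < lamb - lam := sub_pos.2 hlamb
  have hB : 0 ≤ B := nonneg_of_mul_nonneg_left ((norm_nonneg _).trans (hF 0)) (Real.exp_pos _)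
  obtain ⟨a, ha⟩ := exists_norm_mul_abs_sub_le η u t
  set c := 2 * Real.pi * (lamb - lam) * ‖u‖ with hc
  have hc0 : 0 < c := by positivity
  set E := Real.exp (-2 * Real.pi * lam * ‖η + t • u‖) * Real.exp (-2 * Real.pi * mu * ‖u‖) with hE
  have hE0 : 0 ≤ E := by positivity
  calc ‖∫ s in (0 : ℝ)..t, α s * F (η + (t - s) • u)‖
      ≤ ∫ s in (0 : ℝ)..t, A * B * E * Real.exp (-c * |s - a|) := by
        refine intervalIntegral.norm_integral_le_of_norm_le ht
          (Filter.Eventually.of_forall fun s hs => ?_)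
          (Continuous.intervalIntegrable (by fun_prop) _ _)
        have htri : ‖η + t • u‖ ≤ ‖η + (t - s) • u‖ + s * ‖u‖ := by
          calc ‖η + t • u‖ = ‖(η + (t - s) • u) + s • u‖ := by
                congr 1
                rw [add_assoc, ← add_smul, sub_add_cancel]
            _ ≤ ‖η + (t - s) • u‖ + ‖s • u‖ := norm_add_le _ _
            _ = ‖η + (t - s) • u‖ + s * ‖u‖ := by
                rw [norm_smul, Real.norm_of_nonneg hs.1.le]
        have hexp : Real.exp (-2 * Real.pi * (lam * s + mu) * ‖u‖)
            * Real.exp (-2 * Real.pi * lamb * ‖η + (t - s) • u‖)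
            ≤ E * Real.exp (-c * |s - a|) := by
          rw [hE, ← Real.exp_add, ← Real.exp_add, ← Real.exp_add, Real.exp_le_exp, hc]
          have h1 := mul_le_mul_of_nonneg_left htri (by positivity : 0 ≤ 2 * Real.pi * lam)
          have h2 := mul_le_mul_of_nonneg_left (ha s)
            (by positivity : 0 ≤ 2 * Real.pi * (lamb - lam))
          nlinarith
        calc ‖α s * F (η + (t - s) • u)‖
            ≤ (A * Real.exp (-2 * Real.pi * (lam * s + mu) * ‖u‖))
              * (B * Real.exp (-2 * Real.pi * lamb * ‖η + (t - s) • u‖)) := by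
              rw [norm_mul]
              exact mul_le_mul (hα s hs.1 hs.2) (hF _) (norm_nonneg _) (by positivity)
          _ = A * B * (Real.exp (-2 * Real.pi * (lam * s + mu) * ‖u‖)
              * Real.exp (-2 * Real.pi * lamb * ‖η + (t - s) • u‖)) := by ring
          _ ≤ A * B * (E * Real.exp (-c * |s - a|)) := by gcongr
          _ = A * B * E * Real.exp (-c * |s - a|) := by ring
    _ ≤ A * B * E * (2 / c) := by
        rw [intervalIntegral.integral_const_mul]
        gcongr
        exact integral_exp_neg_mul_abs_sub_le hc0 ht a
    _ = A * B / (Real.pi * (lamb - lam) * ‖u‖) * E := by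
        rw [hc]
        field_simp

theorem vec_ne_zero {k : Fin 3 → ℤ} (hk : k ≠ 0) : vec k ≠ 0 := by
  contrapose! hk
  funext i
  have := congrArg (fun x : V3 => x i) hk
  simpa [vec] using this

theorem vec_zero : vec 0 = 0 := by
  ext i
  simp [vec]

/-- The increment is `ħ|κ|/m` times the finite difference, which is constant in `x` and so equals
its torus average. -/
theorem norm_fourier_increment_le {hbar m lamb mub δ₀ : ℝ} {b : ℝ → ℝ → ℝ} {w0 : V3 → ℝ}
    (hbar0 : 0 < hbar) (hm : 0 < m) (hlamb : 0 < lamb) (hδ : 0 ≤ δ₀)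
    (hb : ∀ t τ : ℝ, 0 < τ → τ ≤ t → 0 < b t τ)
    (hst : StabilityCondition hbar m lamb mub δ₀ b w0) {k : Fin 3 → ℤ} (hk : k ≠ 0) (ξ : V3) :
    ‖𝓕 (increment hbar m w0 k) ξ‖
      ≤ (hbar / m * (2 * Real.pi * ‖vec k‖) * δ₀) * Real.exp (-2 * Real.pi * lamb * ‖ξ‖) := by
  have hvec : 0 < ‖vec k‖ := norm_pos_iff.2 (vec_ne_zero hk)
  have hb1 := hb 1 1 one_pos le_rfl
  -- The target does not depend on `(t, τ)`, so one instance suffices; positivity of `b` makes its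
  -- rate at least `lamb`.
  have h := (hst k hk 1 1 one_pos le_rfl).1
  have hlam' : 0 < lamb * (1 + b 1 1) := by positivity
  have hdecay := norm_fourier_le_of_shiftedNorm_le hlam' hδ h ξ
  have hnorm : ‖(2 * Real.pi) • vec k‖ = 2 * Real.pi * ‖vec k‖ := by
    rw [norm_smul, Real.norm_of_nonneg (by positivity)]
  have heq : increment hbar m w0 k = fun v => ((hbar / m * (2 * Real.pi * ‖vec k‖) : ℝ) : ℂ)
      * ((∫ x : T3, deltaW hbar m k (fun _ v' => w0 v') x v : ℝ) : ℂ) := by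
    funext v
    simp only [deltaW, integral_const, probReal_univ, one_smul, hnorm, increment]
    rw [← Complex.ofReal_mul, mul_div_cancel₀ _ (by positivity), Complex.ofReal_sub]
  have hfour : 𝓕 (increment hbar m w0 k) ξ = ((hbar / m * (2 * Real.pi * ‖vec k‖) : ℝ) : ℂ)
      * 𝓕 (fun v => ((∫ x : T3, deltaW hbar m k (fun _ v' => w0 v') x v : ℝ) : ℂ)) ξ := by
    rw [heq, fourier_eq_integral_exp_mul, fourier_eq_integral_exp_mul, ← integral_const_mul]
    congr 1 with v
    ring
  rw [hfour, norm_mul, Complex.norm_real, Real.norm_of_nonneg (by positivity), mul_assoc _ δ₀]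
  gcongr
  refine hdecay.trans (mul_le_mul_of_nonneg_left (Real.exp_le_exp.2 ?_) hδ)
  have h2 : 0 ≤ 2 * Real.pi * ‖ξ‖ * (lamb * b 1 1) := by positivity
  nlinarith

/-- A single term of the nonnegative series over `l` already obeys the bound, and its weight
`e^{2πμ|k|}` moves to the right-hand side. -/
theorem norm_fourierXV_le_of_normZ_le {lam mu δ₀ : ℝ} (hlam : 0 < lam) (hδ : 0 ≤ δ₀)
    {f : T3 → V3 → ℝ} (h : normZ lam mu 1 0 f ≤ ENNReal.ofReal δ₀) (k : Fin 3 → ℤ) (η : V3) :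
    ‖fourierXV f k η‖
      ≤ δ₀ * (Real.exp (-2 * Real.pi * lam * ‖η‖) * Real.exp (-2 * Real.pi * mu * ‖vec k‖)) := by
  have hk := (ENNReal.le_tsum k).trans h
  simp only [mul_zero, zero_smul] at hk
  have hk' : shiftedNorm lam 1 0 (fun v => fourierX (fun x => f x v) k)
      ≤ ENNReal.ofReal (δ₀ * Real.exp (-2 * Real.pi * mu * ‖vec k‖)) := by
    have hpos := Real.exp_pos (2 * Real.pi * mu * ‖vec k‖)
    rw [show -2 * Real.pi * mu * ‖vec k‖ = -(2 * Real.pi * mu * ‖vec k‖) by ring, Real.exp_neg,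
      ← div_eq_mul_inv, ENNReal.ofReal_div_of_pos hpos]
    rw [ENNReal.le_div_iff_mul_le (Or.inl (by simpa using hpos)) (Or.inl ENNReal.ofReal_ne_top),
      mul_comm]
    exact hk
  refine (norm_fourier_le_of_shiftedNorm_le hlam (by positivity) hk' η).trans (le_of_eq ?_)
  ring

theorem fourierX_const (c : ℝ) (k : Fin 3 → ℤ) :
    fourierX (fun _ => c) k = if k = 0 then (c : ℂ) else 0 := by
  rw [fourierX_eq_integral, integral_mul_const]
  split_ifs with hk
  · simp [hk, UnitAddTorus.mFourier_zero]
  · have hvec : ‖vec k‖ ≠ 0 := norm_ne_zero_iff.2 (vec_ne_zero hk)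
    -- Translation by `k/(2|k|²)` multiplies the coefficient by `e^{iπ} = -1` but fixes the constant
    -- function, so the coefficient is its own negative.
    have h := integral_mFourier_mul_translate (fun _ => (1 : ℂ)) k ((2 * ‖vec k‖ ^ 2)⁻¹ • vec k)
    rw [real_inner_smul_left, real_inner_self_eq_norm_sq,
      show 2 * Real.pi * ((2 * ‖vec k‖ ^ 2)⁻¹ * ‖vec k‖ ^ 2) = Real.pi by field_simp,
      Complex.exp_pi_mul_I] at h
    simp only [mul_one, neg_one_mul] at h
    rw [self_eq_neg.1 h, zero_mul]

theorem fourierX_meanDensity (f : T3 → V3 → ℝ) (k : Fin 3 → ℤ) :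
    fourierX (meanDensity f) k = if k = 0 then ((∫ x : T3, ∫ v : V3, f x v : ℝ) : ℂ) else 0 :=
  fourierX_const _ k

/-! ### The frozen zero mode and the bootstrap for the nonzero modes. -/

namespace IsSolution

variable {hbar m e lam lamb mu mub C₀ δ₀ : ℝ} {b : ℝ → ℝ → ℝ} {W : T3 → ℝ} {w0 : V3 → ℝ}
  {wI : T3 → V3 → ℝ} {w : ℝ → T3 → V3 → ℝ}

/-- The mode `k = 0` does not evolve. -/
theorem fourierXV_zero (hsol : IsSolution hbar m e W w0 wI w) (hbar0 : hbar ≠ 0) (hm : m ≠ 0)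
    (hlam : 0 < lam) (hC₀ : 0 ≤ C₀) (hw0 : normC lam 1 w0 ≤ ENNReal.ofReal C₀) (hW : Integrable W)
    (hW0 : fourierX W 0 = 0) {t : ℝ} (ht : 0 ≤ t) (η : V3) :
    fourierXV (w t) 0 η = fourierXV wI 0 η := by
  obtain ⟨α, hα, hduh⟩ := hsol.exists_duhamel hbar0 hm hlam hC₀ hw0 hW 0
  rw [hduh t ht η, intervalIntegral.integral_of_le ht, setIntegral_eq_zero_of_forall_eq_zero]
  · simp [vec_zero]
  · intro s hs
    have h := hα s hs.1
    rw [hW0, norm_zero, mul_zero, zero_mul, norm_le_zero_iff] at h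
    rw [h, zero_mul]

/-- Exponential decay of the nonzero modes, for a small stability constant. -/
theorem norm_fourierXV_le (hsol : IsSolution hbar m e W w0 wI w) (hbar0 : 0 < hbar) (hm : 0 < m)
    (hlam : 0 < lam) (hlamb : lam < lamb) (hC₀ : 0 ≤ C₀) (hδ₀ : 0 ≤ δ₀)
    (hsmall : 4 * |e| * δ₀ ≤ m * (lamb - lam))
    (hb : ∀ t τ : ℝ, 0 < τ → τ ≤ t → 0 < b t τ) (hW : Integrable W) {k : Fin 3 → ℤ} (hk : k ≠ 0)
    (hWk : ‖fourierX W k‖ ≤ 1) (hw0 : normC lam 1 w0 ≤ ENNReal.ofReal C₀)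
    (hwI : normZ lam mu 1 0 wI ≤ ENNReal.ofReal δ₀)
    (hst : StabilityCondition hbar m lamb mub δ₀ b w0) {t : ℝ} (ht : 0 ≤ t) (η : V3) :
    ‖fourierXV (w t) k η‖ ≤ 2 * δ₀ * (Real.exp (-2 * Real.pi * lam * ‖η + t • vec k‖)
      * Real.exp (-2 * Real.pi * mu * ‖vec k‖)) := by
  have hvec : 0 < ‖vec k‖ := norm_pos_iff.2 (vec_ne_zero hk)
  have hgap : 0 < lamb - lam := sub_pos.2 hlamb
  obtain ⟨α, hα, hduh⟩ := hsol.exists_duhamel hbar0.ne' hm.ne' hlam hC₀ hw0 hW k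
  have hF := norm_fourier_increment_le hbar0 hm (hlam.trans hlamb) hδ₀ hb hst hk
  -- One Duhamel iteration: a weighted density bound `S` up to time `r` yields the mode bound with
  -- constant `δ₀ + S/2`. It is used at `ξ = 0` to close the estimate for `S`, then at general `η`
  -- to conclude.
  have hstep : ∀ S : ℝ, 0 ≤ S → ∀ r, 0 ≤ r →
      (∀ s, 0 < s → s ≤ r → ‖fourierX (density (w s)) k‖
        ≤ S * Real.exp (-2 * Real.pi * (lam * s + mu) * ‖vec k‖)) →
      ∀ ξ : V3, ‖fourierXV (w r) k ξ‖
        ≤ (δ₀ + S / 2) * (Real.exp (-2 * Real.pi * lam * ‖ξ + r • vec k‖)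
          * Real.exp (-2 * Real.pi * mu * ‖vec k‖)) := by
    intro S hS r hr hρ ξ
    have hαS : ∀ s, 0 < s → s ≤ r → ‖α s‖
        ≤ |e| * S * Real.exp (-2 * Real.pi * (lam * s + mu) * ‖vec k‖) := by
      intro s hs hsr
      calc ‖α s‖ ≤ |e| * ‖fourierX W k‖ * ‖fourierX (density (w s)) k‖ := hα s hs
        _ ≤ |e| * 1 * (S * Real.exp (-2 * Real.pi * (lam * s + mu) * ‖vec k‖)) := by
            gcongr
            exact hρ s hs hsr
        _ = _ := by ring
    have hintg := norm_integral_mul_le hlam hlamb (by positivity) hr (vec_ne_zero hk) hαS hF ξ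
    have hini := norm_fourierXV_le_of_normZ_le hlam hδ₀ hwI k (ξ + r • vec k)
    set E := Real.exp (-2 * Real.pi * lam * ‖ξ + r • vec k‖)
      * Real.exp (-2 * Real.pi * mu * ‖vec k‖) with hE
    have hE0 : 0 ≤ E := by positivity
    -- Both `ħ` and `|k|` cancel, leaving `4|e|δ₀/(m(lamb - lam)) · S/2`; the smallness assumption
    -- says exactly that the quotient is at most `1`.
    have hcoef : 1 / hbar * (|e| * S * (hbar / m * (2 * Real.pi * ‖vec k‖) * δ₀)
        / (Real.pi * (lamb - lam) * ‖vec k‖)) ≤ S / 2 := by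
      have : 1 / hbar * (|e| * S * (hbar / m * (2 * Real.pi * ‖vec k‖) * δ₀)
          / (Real.pi * (lamb - lam) * ‖vec k‖))
          = (4 * |e| * δ₀) / (m * (lamb - lam)) * (S / 2) := by
        field_simp
        ring
      rw [this]
      exact mul_le_of_le_one_left (by positivity) ((div_le_one (by positivity)).2 hsmall)
    rw [hduh r hr ξ]
    refine (norm_add_le _ _).trans ?_
    rw [add_mul]
    refine add_le_add hini ?_
    rw [norm_mul, norm_div, Complex.norm_I, Complex.norm_real, Real.norm_of_nonneg hbar0.le]
    refine (mul_le_mul_of_nonneg_left hintg (by positivity)).trans ?_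
    rw [← mul_assoc]
    exact mul_le_mul_of_nonneg_right hcoef hE0
  set wt : ℝ → ℝ := fun s => Real.exp (2 * Real.pi * (lam * s + mu) * ‖vec k‖) with hwt
  have hwt_inv : ∀ s, Real.exp (-2 * Real.pi * (lam * s + mu) * ‖vec k‖) = (wt s)⁻¹ := by
    intro s
    rw [hwt, ← Real.exp_neg]
    ring_nf
  have hwt_pos : ∀ s, 0 < wt s := fun s => Real.exp_pos _
  set P : Set ℝ := (fun s => ‖fourierX (density (w s)) k‖ * wt s) '' Set.Icc 0 t with hP
  have hPne : P.Nonempty := ⟨_, 0, ⟨le_rfl, ht⟩, rfl⟩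
  have hPbdd : BddAbove P := by
    obtain ⟨B, hB0, hB⟩ := hsol.exists_source_bound k t
    refine ⟨B * wt t, ?_⟩
    rintro _ ⟨s, hs, rfl⟩
    have hwt_le : wt s ≤ wt t := by
      simp only [hwt]
      gcongr
      exact hs.2
    exact mul_le_mul (hB s hs.1 hs.2) hwt_le (hwt_pos s).le hB0
  set S := sSup P with hS
  have hS0 : 0 ≤ S := (by positivity : 0 ≤ ‖fourierX (density (w 0)) k‖ * wt 0).trans
    (le_csSup hPbdd ⟨0, ⟨le_rfl, ht⟩, rfl⟩)
  have hρS : ∀ s, 0 ≤ s → s ≤ t → ‖fourierX (density (w s)) k‖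
      ≤ S * Real.exp (-2 * Real.pi * (lam * s + mu) * ‖vec k‖) := by
    intro s hs hst
    rw [hwt_inv, ← div_eq_mul_inv, le_div_iff₀ (hwt_pos s)]
    exact le_csSup hPbdd ⟨s, ⟨hs, hst⟩, rfl⟩
  -- At frequency `0` the free-transport weight is `e^{-2πλs|k|}`, precisely the weight in the
  -- definition of `S`. As `S` is finite, it can be absorbed.
  have hSle : S ≤ δ₀ + S / 2 := by
    refine csSup_le hPne ?_
    rintro _ ⟨s, hs, rfl⟩
    have h := hstep S hS0 s hs.1 (fun r hr hrs => hρS r hr.le (hrs.trans hs.2)) 0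
    rw [← fourierX_density (hsol.integrable s hs.1), zero_add, norm_smul,
      Real.norm_of_nonneg hs.1, ← Real.exp_add,
      show -2 * Real.pi * lam * (s * ‖vec k‖) + -2 * Real.pi * mu * ‖vec k‖
        = -2 * Real.pi * (lam * s + mu) * ‖vec k‖ by ring, hwt_inv, ← div_eq_mul_inv,
      le_div_iff₀ (hwt_pos s)] at h
    exact h
  refine (hstep S hS0 t ht (fun s hs hst => hρS s hs.le hst) η).trans ?_
  gcongr
  linarith

end IsSolution

end QuantumLandau

/-! ### Assembly of the three estimates. -/

theorem theorem4p1 :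
    ∃ C : ℝ → ℝ → ℝ,
      ∀ (e m γ lam lamb mu mub C₀ : ℝ), 0 < m → 1 ≤ γ → 0 < lam → lam < lamb →
        0 < mu → mu < mub → 0 < C₀ →
      ∃ δs : ℝ, 0 < δs ∧
        ∀ (hbar δ₀ : ℝ), 0 < hbar → 0 < δ₀ → δ₀ ≤ δs →
        ∀ (b : ℝ → ℝ → ℝ), (∀ t τ : ℝ, 0 < τ → τ ≤ t → 0 < b t τ) →
        ∀ (W : T3 → ℝ) (w0 : V3 → ℝ) (wI : T3 → V3 → ℝ) (w : ℝ → T3 → V3 → ℝ),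
          MeasureTheory.Integrable W →
          fourierX W 0 = 0 →
          (∀ k : Fin 3 → ℤ, ‖fourierX W k‖ ≤ 1 / (1 + ‖vec k‖ ^ γ)) →
          normC lam 1 w0 ≤ ENNReal.ofReal C₀ →
          normZ lam mu 1 0 wI ≤ ENNReal.ofReal δ₀ →
          StabilityCondition hbar m lamb mub δ₀ b w0 →
          IsSolution hbar m e W w0 wI w →
          ∀ (t : ℝ), 0 ≤ t → ∀ (k : Fin 3 → ℤ) (η : V3),
            ‖fourierXV (w t) k η - fourierXV (spatialMean wI) k η‖
                ≤ C C₀ δ₀ * Real.exp (-2 * Real.pi * lam * ‖η + t • vec k‖)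
                  * Real.exp (-2 * Real.pi * mu * ‖vec k‖) ∧
            ‖fourierX (density (w t)) k - fourierX (meanDensity wI) k‖
                ≤ C C₀ δ₀ * Real.exp (-2 * Real.pi * (lam * t + mu) * ‖vec k‖) ∧
            ‖fourierX (potential W (density (w t))) k‖
                ≤ C C₀ δ₀ * Real.exp (-2 * Real.pi * lam * ‖vec k‖ * t)
                  * Real.exp (-2 * Real.pi * mu * ‖vec k‖) := by
  refine ⟨fun _ δ₀ => 2 * δ₀, ?_⟩
  intro e m γ lam lamb mu mub C₀ hm _ hlam hlamb _ _ hC₀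
  have hgap : 0 < lamb - lam := sub_pos.2 hlamb
  -- The `+ 1` keeps the threshold meaningful when `e = 0`.
  refine ⟨m * (lamb - lam) / (4 * (|e| + 1)), by positivity, ?_⟩
  intro hbar δ₀ hbar0 hδ₀ hδs b hb W w0 wI w hW hW0 hWk hw0 hwI hst hsol t ht k η
  have hn := integrable_density (hsol.integrable t ht)
  have hwIi : Integrable fun p : T3 × V3 => wI p.1 p.2 := by
    simpa [hsol.initial] using hsol.integrable 0 le_rfl
  rcases eq_or_ne k 0 with rfl | hk
  · have hfree := hsol.fourierXV_zero hbar0.ne' hm.ne' hlam hC₀.le hw0 hW hW0 ht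
    have hmean : fourierXV (spatialMean wI) 0 η = fourierXV wI 0 η := by
      simp only [fourierXV, spatialMean, fourierX_const, if_true]
      simp [fourierX_eq_integral, UnitAddTorus.mFourier_zero, integral_complex_ofReal]
    have hdens : fourierX (density (w t)) 0 = fourierX (meanDensity wI) 0 := by
      rw [fourierX_density (hsol.integrable t ht), hfree, ← fourierX_density hwIi,
        fourierX_meanDensity, if_pos rfl, fourierX_eq_integral]
      simp [UnitAddTorus.mFourier_zero, integral_complex_ofReal, density]
    refine ⟨?_, ?_, ?_⟩
    · rw [hfree, hmean, sub_self, norm_zero]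
      positivity
    · rw [hdens, sub_self, norm_zero]
      positivity
    · rw [fourierX_potential hW hn, hW0, zero_mul, norm_zero]
      positivity
  · have hWk1 : ‖fourierX W k‖ ≤ 1 := by
      refine (hWk k).trans ((div_le_one (by positivity)).2 ?_)
      have : 0 ≤ ‖vec k‖ ^ γ := by positivity
      linarith
    have hsmall : 4 * |e| * δ₀ ≤ m * (lamb - lam) := by
      rw [le_div_iff₀ (by positivity)] at hδs
      linarith
    have hmode := hsol.norm_fourierXV_le hbar0 hm hlam hlamb hC₀.le hδ₀.le hsmall hb hW hk hWk1
      hw0 hwI hst ht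
    have hmean : fourierXV (spatialMean wI) k η = 0 := by
      simp only [fourierXV, spatialMean, fourierX_const, if_neg hk]
      simp [fourier_eq_integral_exp_mul]
    have hmeand : fourierX (meanDensity wI) k = 0 := by
      rw [fourierX_meanDensity, if_neg hk]
    have hdens : ‖fourierX (density (w t)) k‖
        ≤ 2 * δ₀ * Real.exp (-2 * Real.pi * (lam * t + mu) * ‖vec k‖) := by
      have h := hmode 0
      rw [← fourierX_density (hsol.integrable t ht), zero_add, norm_smul, Real.norm_of_nonneg ht,
        ← Real.exp_add, show -2 * Real.pi * lam * (t * ‖vec k‖) + -2 * Real.pi * mu * ‖vec k‖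
          = -2 * Real.pi * (lam * t + mu) * ‖vec k‖ by ring] at h
      exact h
    refine ⟨?_, ?_, ?_⟩
    · rw [hmean, sub_zero, mul_assoc]
      exact hmode η
    · rw [hmeand, sub_zero]
      exact hdens
    · rw [fourierX_potential hW hn, norm_mul, mul_assoc, ← Real.exp_add,
        show -2 * Real.pi * lam * ‖vec k‖ * t + -2 * Real.pi * mu * ‖vec k‖
          = -2 * Real.pi * (lam * t + mu) * ‖vec k‖ by ring]
      exact (mul_le_of_le_one_left (norm_nonneg _) hWk1).trans hdens
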